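/- Let $k$ be a field. All algebras are associative $k$-algebras, possibly without unit; $\otimes=\otimes_k$, and the identity map of a vector space $V$ is also written $V$. In formulas such as $(a\otimes 1)x$ the symbol $1$ acts as the identity; for a linear map $f$ on $A\otimes A$, $f^{13}$ denotes $f$ acting on the first and third factors of $A\otimes A\otimes A$; $\mathsf{tw}$ is the flip and $\langle\dots\rangle$ denotes linear span. **Weak multiplier bialgebras.** Let $A$ be an algebra with multiplication $\mu:A\otimes A\to A$ which is idempotent ($\mu$ is surjective) and non-degenerate (if $ab=0$ for all $b$, or $ba=0$ for all $b$, then $a=0$). A *multiplier* on $A$ is a pair $(l,r)$ of linear maps $A\to A$ with $a\,l(b)=r(a)\,b$ for all $a,b$; multipliers form a unital algebra $\mathbb M(A)$ with product $(l,r)(l',r')=(ll',r'r)$, and for $m=(l,r)$ one writes $ma=l(a)$, $am=r(a)$. A *regular weak multiplier bialgebra* structure on $A$ consists of linear maps $E_1,E_2,T_1,T_2,T_3,T_4:A\otimes A\to A\otimes A$ and $\epsilon:A\to k$ such that, for all $a,b,c,d\in A$: 1. $(a\otimes b)E_1(c\otimes d)=E_2(a\otimes b)(c\otimes d)$ and $E_1^2=E_1$;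 2. $(T_2\otimes A)(A\otimes T_1)=(A\otimes T_1)(T_2\otimes A)$ and $(\epsilon\otimes A)T_1=\mu=(A\otimes\epsilon)T_2$; 3. $(\mu\otimes A)T_1^{13}(A\otimes T_1)=T_1(\mu\otimes A)$; 4. $\langle T_1(a\otimes c)(b\otimes 1)\mid a,b,c\in A\rangle=\langle E_1(b\otimes c)\mid b,c\in A\rangle$ and $\langle(1\otimes c)T_2(b\otimes a)\mid a,b,c\in A\rangle=\langle E_2(b\otimes c)\mid b,c\in A\rangle$; 5. $(E_1\otimes A)(A\otimes T_1)=(A\otimes T_1)(E_1\otimes A)$ and $(E_2\otimes A)(A\otimes T_2)=(A\otimes T_2)E_2^{13}$; 6. $(\epsilon\otimes A)((1\otimes a)E_1(b\otimes c))=(\epsilon\otimes A)(T_1(a\otimes c)(b\otimes1))$ and $(\epsilon\otimes A)(E_2(a\otimes b)(1\otimes c))=(\epsilon\otimes A)((1\otimes b)T_2(a\otimes c))$; 7. $(1\otimes a)T_1(c\otimes b)=T_3(c\otimes a)(1\otimes b)$ and $T_2(a\otimes c)(b\otimes1)=(a\otimes1)T_4(b\otimes c)$. Its comultiplication is *right full*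 if $\langle(A\otimes\omega)T_1(a\otimes b)\mid a,b\in A,\ \omega\in\mathsf{Lin}(A,k)\rangle=A$. **The base algebra.** Linear maps $\sqcap^R,\overline\sqcap^R:A\to\mathbb M(A)$ are given by $$\sqcap^R(a)b=(A\otimes\epsilon)T_3(b\otimes a),\quad b\sqcap^R(a)=(A\otimes\epsilon)E_2(b\otimes a),\quad \overline\sqcap^R(a)b=(A\otimes\epsilon)E_1(b\otimes a),\quad b\overline\sqcap^R(a)=(A\otimes\epsilon)T_1(b\otimes a),$$ and a multiplier $F$ on $A\otimes A$ is given by $$F(a\otimes bc)=((\overline\sqcap^R\otimes A)\mathsf{tw}\,T_4(c\otimes b))(a\otimes1),\qquad (ab\otimes c)F=(1\otimes c)((A\otimes\sqcap^R)T_2(a\otimes b)).$$ **Proposition.** Let $A$ be a regular weak multiplier bialgebra over $k$ with right full comultiplication. Then $\sqcap^R$ and $\overline\sqcap^R$ have the same range $R$, which is a (non-unital) subalgebra of $\mathbb M(A)$; the multiplier $F$ exists; and there are well-defined linear maps $$\delta:R\to R\otimes R,\quad \delta(\sqcap^R(a))=(\sqcap^R(a)\otimes1)F=F(1\otimes\sqcap^R(a)),\qquad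 \varepsilon:R\to k,\quad \varepsilon(\sqcap^R(a))=\epsilon(a).$$ Let $M$ be any firm right $R$-module, i.e. a vector space with a linear associative action $M\otimes R\to M$ inducing an isomorphism $M\otimes_RR\to M$. Let $\mathsf{Lin}(M,k)$ be the space of linear maps $M\to k$ and $\mathsf{Hom}_R(M,R)$ the space of right $R$-module maps $M\to R$. Then $$\mathsf{Hom}_R(M,R)\to\mathsf{Lin}(M,k),\quad \Psi\mapsto\varepsilon\Psi,\qquad\text{and}\qquad \mathsf{Lin}(M,k)\to\mathsf{Hom}_R(M,R),\quad \psi\mapsto\bigl[mr\mapsto(\psi\otimes R)((m\otimes1)\delta(r))\bigr]$$ are well-defined, mutually inverse isomorphisms of vector spaces. -/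

import Mathlib

open scoped TensorProduct

universe u v w

noncomputable section

namespace WMB

/-! ### Multipliers of a possibly non-unital algebra -/

section Multipliers

variable (k : Type u) [Field k]

/-- Pairs `(l, r)` of linear endomorphisms of `A`, with product `(l, r) (l', r') = (l l', r' r)`
and unit `(id, id)`. A pair acts on `A` from the left by `l` and from the right by `r`. -/
abbrev MulPair (A : Type v) [AddCommGroup A] [Module k A] : Type v :=
  Module.End k A × (Module.End k A)ᵐᵒᵖ

variable {k}

/-- The left action `p ↦ p a` of pairs on a fixed element `a`. -/
def actOn {A : Type v} [AddCommGroup A] [Module k A] (a : A) : MulPair k A →ₗ[k] A :=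
  (LinearMap.applyₗ a) ∘ₗ LinearMap.fst k (Module.End k A) (Module.End k A)ᵐᵒᵖ

/-- The right action `p ↦ a p` of pairs on a fixed element `a`. -/
def onAct {A : Type v} [AddCommGroup A] [Module k A] (a : A) : MulPair k A →ₗ[k] A :=
  (LinearMap.applyₗ a) ∘ₗ (MulOpposite.opLinearEquiv k).symm.toLinearMap ∘ₗ
    LinearMap.snd k (Module.End k A) (Module.End k A)ᵐᵒᵖ

variable (k) in
/-- The multiplier algebra of `A`: all pairs `(l, r)` with `a * l b = r a * b`. -/
def multiplierAlgebra (A : Type v) [NonUnitalRing A] [Module k A]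
    [IsScalarTower k A A] [SMulCommClass k A A] :
    Subalgebra k (MulPair k A) where
  carrier := {p | ∀ a b : A, a * actOn b p = onAct a p * b}
  mul_mem' := by
    intro p q hp hq a b
    have h1 := hp a (actOn b q)
    have h2 := hq (onAct a p) b
    exact h1.trans h2
  one_mem' := by intro a b; rfl
  add_mem' := by
    intro p q hp hq a b
    rw [map_add, map_add, mul_add, add_mul, hp a b, hq a b]
  zero_mem' := by intro a b; simp
  algebraMap_mem' := by
    intro c a b
    change a * (c • b) = (c • a) * b
    rw [mul_smul_comm, smul_mul_assoc]

/-- The tensor product of pairs, `(p ⊗ q) (a ⊗ b) = p a ⊗ q b` and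
`(a ⊗ b) (p ⊗ q) = a p ⊗ b q`. -/
def pairTensor {A : Type v} [AddCommGroup A] [Module k A] :
    MulPair k A ⊗[k] MulPair k A →ₗ[k] MulPair k (A ⊗[k] A) :=
  TensorProduct.lift (LinearMap.mk₂ k
    (fun p q => (TensorProduct.map p.1 q.1,
      MulOpposite.op (TensorProduct.map p.2.unop q.2.unop)))
    (by intros; ext <;> simp [TensorProduct.map_add_left])
    (by intros; ext <;> simp [TensorProduct.map_smul_left])
    (by intros; ext <;> simp [TensorProduct.map_add_right])
    (by intros; ext <;> simp [TensorProduct.map_smul_right]))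

end Multipliers

section Legs

variable {k : Type u} [Field k] {A : Type v}

section
variable [AddCommGroup A] [Module k A]

/-- `ω ⊗ A : A ⊗ A → k ⊗ A ≅ A`. -/
def sliceL (ω : A →ₗ[k] k) : A ⊗[k] A →ₗ[k] A :=
  (TensorProduct.lid k A).toLinearMap ∘ₗ LinearMap.rTensor A ω

/-- `A ⊗ ω : A ⊗ A → A ⊗ k ≅ A`. -/
def sliceR (ω : A →ₗ[k] k) : A ⊗[k] A →ₗ[k] A :=
  (TensorProduct.rid k A).toLinearMap ∘ₗ LinearMap.lTensor A ω

/-- `f ⊗ A` on `A ⊗ A ⊗ A`. -/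
def on12 (f : A ⊗[k] A →ₗ[k] A ⊗[k] A) : A ⊗[k] (A ⊗[k] A) →ₗ[k] A ⊗[k] (A ⊗[k] A) :=
  (TensorProduct.assoc k A A A).toLinearMap ∘ₗ LinearMap.rTensor A f ∘ₗ
    (TensorProduct.assoc k A A A).symm.toLinearMap

/-- `A ⊗ f` on `A ⊗ A ⊗ A`. -/
def on23 (f : A ⊗[k] A →ₗ[k] A ⊗[k] A) : A ⊗[k] (A ⊗[k] A) →ₗ[k] A ⊗[k] (A ⊗[k] A) :=
  LinearMap.lTensor A f

/-- `f` acting on the first and the third leg of `A ⊗ A ⊗ A`. -/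
def on13 (f : A ⊗[k] A →ₗ[k] A ⊗[k] A) : A ⊗[k] (A ⊗[k] A) →ₗ[k] A ⊗[k] (A ⊗[k] A) :=
  LinearMap.lTensor A (TensorProduct.comm k A A).toLinearMap ∘ₗ on12 f ∘ₗ
    LinearMap.lTensor A (TensorProduct.comm k A A).toLinearMap

end

section
variable [NonUnitalRing A] [Module k A] [IsScalarTower k A A] [SMulCommClass k A A]

/-- `x ↦ (a ⊗ 1) x` on `A ⊗ A`. -/
def mulL1 (a : A) : A ⊗[k] A →ₗ[k] A ⊗[k] A := LinearMap.rTensor A (LinearMap.mulLeft k a)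

/-- `x ↦ (1 ⊗ a) x` on `A ⊗ A`. -/
def mulL2 (a : A) : A ⊗[k] A →ₗ[k] A ⊗[k] A := LinearMap.lTensor A (LinearMap.mulLeft k a)

/-- `x ↦ x (a ⊗ 1)` on `A ⊗ A`. -/
def mulR1 (a : A) : A ⊗[k] A →ₗ[k] A ⊗[k] A := LinearMap.rTensor A (LinearMap.mulRight k a)

/-- `x ↦ x (1 ⊗ a)` on `A ⊗ A`. -/
def mulR2 (a : A) : A ⊗[k] A →ₗ[k] A ⊗[k] A := LinearMap.lTensor A (LinearMap.mulRight k a)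

variable (k A) in
/-- `μ ⊗ A : A ⊗ A ⊗ A → A ⊗ A`. -/
def mu12 : A ⊗[k] (A ⊗[k] A) →ₗ[k] A ⊗[k] A :=
  LinearMap.rTensor A (LinearMap.mul' k A) ∘ₗ (TensorProduct.assoc k A A A).symm.toLinearMap

end

end Legs

/-! ### Weak multiplier bialgebras -/

/-- A weak multiplier bialgebra structure on the (possibly non-unital) `k`-algebra `A`. -/
structure WeakMultiplierBialgebra (k : Type u) [Field k] (A : Type v) [NonUnitalRing A]
    [Module k A] [IsScalarTower k A A] [SMulCommClass k A A] where
  /-- `A` is idempotent. -/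
  idempotent : Function.Surjective (LinearMap.mul' k A)
  nondeg_left : ∀ a : A, (∀ b : A, a * b = 0) → a = 0
  nondeg_right : ∀ a : A, (∀ b : A, b * a = 0) → a = 0
  E₁ : A ⊗[k] A →ₗ[k] A ⊗[k] A
  E₂ : A ⊗[k] A →ₗ[k] A ⊗[k] A
  T₁ : A ⊗[k] A →ₗ[k] A ⊗[k] A
  T₂ : A ⊗[k] A →ₗ[k] A ⊗[k] A
  /-- The counit of `A`. -/
  counit : A →ₗ[k] k
  E_compat : ∀ a b c d : A, (a ⊗ₜ[k] b) * E₁ (c ⊗ₜ[k] d) = E₂ (a ⊗ₜ[k] b) * (c ⊗ₜ[k] d)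
  E_idem : E₁ ∘ₗ E₁ = E₁
  coassoc : on12 T₂ ∘ₗ on23 T₁ = on23 T₁ ∘ₗ on12 T₂
  counit_T₁ : sliceL counit ∘ₗ T₁ = LinearMap.mul' k A
  counit_T₂ : sliceR counit ∘ₗ T₂ = LinearMap.mul' k A
  T₁_mul : mu12 k A ∘ₗ on13 T₁ ∘ₗ on23 T₁ = T₁ ∘ₗ mu12 k A
  span_E₁ : Submodule.span k {x | ∃ a b c : A, x = mulR1 b (T₁ (a ⊗ₜ[k] c))} =
    Submodule.span k {x | ∃ b c : A, x = E₁ (b ⊗ₜ[k] c)}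
  span_E₂ : Submodule.span k {x | ∃ a b c : A, x = mulL2 c (T₂ (b ⊗ₜ[k] a))} =
    Submodule.span k {x | ∃ b c : A, x = E₂ (b ⊗ₜ[k] c)}
  E₁_T₁ : on12 E₁ ∘ₗ on23 T₁ = on23 T₁ ∘ₗ on12 E₁
  E₂_T₂ : on12 E₂ ∘ₗ on23 T₂ = on23 T₂ ∘ₗ on13 E₂
  counit_E₁ : ∀ a b c : A, sliceL counit (mulL2 a (E₁ (b ⊗ₜ[k] c))) =
    sliceL counit (mulR1 b (T₁ (a ⊗ₜ[k] c)))
  counit_E₂ : ∀ a b c : A, sliceL counit (mulR2 c (E₂ (a ⊗ₜ[k] b))) =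
    sliceL counit (mulL2 b (T₂ (a ⊗ₜ[k] c)))

/-- A regular weak multiplier bialgebra. The maps `T₃`, `T₄` are uniquely determined by the
axioms, because `A` is non-degenerate. -/
structure RegularWMB (k : Type u) [Field k] (A : Type v) [NonUnitalRing A]
    [Module k A] [IsScalarTower k A A] [SMulCommClass k A A] extends
    WeakMultiplierBialgebra k A where
  T₃ : A ⊗[k] A →ₗ[k] A ⊗[k] A
  T₄ : A ⊗[k] A →ₗ[k] A ⊗[k] A
  T₁_T₃ : ∀ a b c : A, mulL2 a (T₁ (c ⊗ₜ[k] b)) = mulR2 b (T₃ (c ⊗ₜ[k] a))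
  T₂_T₄ : ∀ a b c : A, mulR1 b (T₂ (a ⊗ₜ[k] c)) = mulL1 a (T₄ (b ⊗ₜ[k] c))

namespace RegularWMB

variable {k : Type u} [Field k] {A : Type v} [NonUnitalRing A] [Module k A]
  [IsScalarTower k A A] [SMulCommClass k A A] (B : RegularWMB k A)

/-- The comultiplication is right full: `A` is spanned by the `(A ⊗ ω) T₁ (a ⊗ b)`. -/
def IsRightFull : Prop :=
  Submodule.span k {x : A | ∃ (a b : A) (ω : A →ₗ[k] k), x = sliceR ω (B.T₁ (a ⊗ₜ[k] b))} = ⊤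

/-- The map `⊓ᴿ`, given by `⊓ᴿ(a) b = (A ⊗ ε) T₃ (b ⊗ a)` and `b ⊓ᴿ(a) = (A ⊗ ε) E₂ (b ⊗ a)`. -/
def piR : A →ₗ[k] MulPair k A :=
  LinearMap.prod (TensorProduct.curry (sliceR B.counit ∘ₗ B.T₃)).flip
    ((MulOpposite.opLinearEquiv k).toLinearMap ∘ₗ
      (TensorProduct.curry (sliceR B.counit ∘ₗ B.E₂)).flip)

/-- The map `⊓̄ᴿ`, given by `⊓̄ᴿ(a) b = (A ⊗ ε) E₁ (b ⊗ a)` and `b ⊓̄ᴿ(a) = (A ⊗ ε) T₁ (b ⊗ a)`. -/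
def piBarR : A →ₗ[k] MulPair k A :=
  LinearMap.prod (TensorProduct.curry (sliceR B.counit ∘ₗ B.E₁)).flip
    ((MulOpposite.opLinearEquiv k).toLinearMap ∘ₗ
      (TensorProduct.curry (sliceR B.counit ∘ₗ B.T₁)).flip)

/-- `R` is the base algebra: a subalgebra of the multiplier algebra which is the
coinciding range of `⊓ᴿ` and `⊓̄ᴿ`. -/
def IsBaseAlgebra (R : NonUnitalSubalgebra k (MulPair k A)) : Prop :=
  (∀ r ∈ R, r ∈ multiplierAlgebra k A) ∧
  R.toSubmodule = LinearMap.range B.piR ∧ R.toSubmodule = LinearMap.range B.piBarR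

/-- `F` is the multiplier on `A ⊗ A` with `F (a ⊗ bc) = ((⊓̄ᴿ ⊗ A) tw T₄ (c ⊗ b)) (a ⊗ 1)` and
`(ab ⊗ c) F = (1 ⊗ c) ((A ⊗ ⊓ᴿ) T₂ (a ⊗ b))`. -/
def IsBaseMultiplier (F : MulPair k (A ⊗[k] A)) : Prop :=
  F ∈ multiplierAlgebra k (A ⊗[k] A) ∧
  (∀ a b c : A, actOn (a ⊗ₜ[k] (b * c)) F =
    LinearMap.rTensor A (actOn a ∘ₗ B.piBarR) (TensorProduct.comm k A A (B.T₄ (c ⊗ₜ[k] b)))) ∧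
  (∀ a b c : A, onAct ((a * b) ⊗ₜ[k] c) F =
    LinearMap.lTensor A (onAct c ∘ₗ B.piR) (B.T₂ (a ⊗ₜ[k] b)))

/-- The embedding of `R ⊗ R` in the pairs on `A ⊗ A`. -/
def tensorIncl (R : NonUnitalSubalgebra k (MulPair k A)) :
    R ⊗[k] R →ₗ[k] MulPair k (A ⊗[k] A) :=
  pairTensor ∘ₗ TensorProduct.map (NonUnitalSubalgebraClass.subtype R : R →ₗ[k] MulPair k A)
    (NonUnitalSubalgebraClass.subtype R : R →ₗ[k] MulPair k A)

/-- `δ` is the comultiplication `⊓ᴿ(a) ↦ (⊓ᴿ(a) ⊗ 1) F = F (1 ⊗ ⊓ᴿ(a))` of `R`. -/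
def IsBaseComul (R : NonUnitalSubalgebra k (MulPair k A)) (F : MulPair k (A ⊗[k] A))
    (δ : R →ₗ[k] R ⊗[k] R) : Prop :=
  ∀ (a : A) (r : R), (r : MulPair k A) = B.piR a →
    tensorIncl R (δ r) = pairTensor (B.piR a ⊗ₜ[k] 1) * F ∧
    tensorIncl R (δ r) = F * pairTensor (1 ⊗ₜ[k] B.piR a)

/-- `ε` is the counit `⊓ᴿ(a) ↦ ε(a)` of `R`. -/
def IsBaseCounit (R : NonUnitalSubalgebra k (MulPair k A)) (ε : R →ₗ[k] k) : Prop :=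
  ∀ (a : A) (r : R), (r : MulPair k A) = B.piR a → ε r = B.counit a

end RegularWMB

/-! ### Firm modules -/

/-- A right module structure on the vector space `M` over the possibly non-unital
`k`-algebra `S`. -/
structure RightModule (k : Type u) [Field k] (S : Type v) [NonUnitalRing S] [Module k S]
    (M : Type w) [AddCommGroup M] [Module k M] where
  act : M →ₗ[k] S →ₗ[k] M
  act_mul : ∀ (m : M) (r s : S), act m (r * s) = act (act m r) s

namespace RightModule

variable {k : Type u} [Field k] {S : Type v} [NonUnitalRing S] [Module k S]
  {M : Type w} [AddCommGroup M] [Module k M] (ρ : RightModule k S M)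

/-- The kernel of `M ⊗ S → M ⊗_S S`. -/
def balanced : Submodule k (M ⊗[k] S) :=
  Submodule.span k {x | ∃ (m : M) (r s : S), x = ρ.act m r ⊗ₜ[k] s - m ⊗ₜ[k] (r * s)}

/-- The map `M ⊗_S S → M` induced by the action. -/
def tensorAct : ((M ⊗[k] S) ⧸ ρ.balanced) →ₗ[k] M :=
  ρ.balanced.liftQ (TensorProduct.lift ρ.act) (by
    rw [balanced, Submodule.span_le]
    rintro _ ⟨m, r, s, rfl⟩
    simp [ρ.act_mul])

/-- `M` is firm: the action induces an isomorphism `M ⊗_S S ≅ M`. -/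
def IsFirm : Prop := Function.Bijective ρ.tensorAct

variable [IsScalarTower k S S] in
/-- The space of right `S`-module maps `M → S`. -/
def homToBase : Submodule k (M →ₗ[k] S) where
  carrier := {f | ∀ (m : M) (s : S), f (ρ.act m s) = f m * s}
  add_mem' := by
    intro f g hf hg m s
    simp [hf m s, hg m s, add_mul]
  zero_mem' := by intro m s; simp
  smul_mem' := by
    intro c f hf m s
    simp [hf m s, smul_mul_assoc]

/-- The element `(ψ ⊗ S) ((m ⊗ 1) x)` of `S`, for `x` in `S ⊗ S`. -/
def slice (ψ : M →ₗ[k] k) (m : M) : S ⊗[k] S →ₗ[k] S :=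
  (TensorProduct.lid k S).toLinearMap ∘ₗ LinearMap.rTensor S (ψ ∘ₗ ρ.act m)

end RightModule

end WMB

end

set_option linter.unusedSectionVars false

/-! Write Δ for the comultiplication, Δ(b) = b₁ ⊗ b₂. Then T₁(a ⊗ b) = Δ(a)(1 ⊗ b), T₂(a ⊗ b) = (a ⊗
1)Δ(b), T₃(a ⊗ b) = (1 ⊗ b)Δ(a), T₄(a ⊗ b) = Δ(b)(a ⊗ 1), and E₁, E₂ are left and right
multiplication by an idempotent multiplier E. Non-degeneracy of `A` survives tensoring over a field,
so identities in `A ⊗ A` may be checked after multiplying any leg by arbitrary elements.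

The module statement is formal once δ is an R-bimodule map with counit ε
(`IsFirm.exists_homToBase_equiv`). Firmness makes m r ↦ m r₁ ⊗ r₂ a well-defined map M → M ⊗ R,
where δ(r) = r₁ ⊗ r₂, and ψ ⊗ R turns it into a module map. One composite sends Ψ to m r ↦ ε(Ψ(m)
r₁) r₂ = Ψ(m) r, the other sends ψ to m r ↦ ψ(m r₁) ε(r₂) = ψ(m r); these are the two counit laws.

The real work is to construct R, F, δ and ε. (1) Both expressions for each ⊓ᴿ(a), ⊓̄ᴿ(a) form a
multiplier: apply A ⊗ ε to a formula for E multiplied by d ⊗ 1 (`mulR1_E₂`, `mulL1_E₁`). (2) The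
ranges agree: (1 ⊗ xy)E(1 ⊗ bc) can be expanded with either map in its first leg, so by right
fullness a functional kills one range exactly when it kills the other. (3) ε descends to R because
every x in `A` lies in xR (`IsRightFull.exists_onAct_eq`). (4) F exists because its two
prescriptions are compatible (`preBaseMul_compat`). (5) (⊓ᴿ ⊗ ⊓ᴿ)T₂ realizes (⊓ᴿ(-) ⊗ 1)F inside R ⊗
R, which gives δ; (r ⊗ 1)F = F(1 ⊗ r) makes it a bimodule map, and the counit laws follow from those
of Δ. -/

noncomputable section

namespace WMB

/-! ### Joint injectivity of families of linear maps after tensoring over a field. -/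

section TensorCancellation

variable {k : Type*} [Field k] {V V' W W' : Type*} [AddCommGroup V] [Module k V]
  [AddCommGroup V'] [Module k V'] [AddCommGroup W] [Module k W] [AddCommGroup W'] [Module k W']

/-- A tensor over a field all of whose right slices vanish is zero. -/
theorem eq_zero_of_forall_lTensor_dual (x : V ⊗[k] W)
    (h : ∀ φ : W →ₗ[k] k, LinearMap.lTensor V φ x = 0) : x = 0 := by
  classical
  let b := Module.Basis.ofVectorSpace k W
  apply (TensorProduct.equivFinsuppOfBasisRight (M := V) b).injective
  rw [map_zero]
  ext i
  -- The coefficient in `V` at a basis vector of `W` is the slice by the corresponding coordinate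
  -- functional.
  have h1 : ∀ y : V ⊗[k] W, TensorProduct.equivFinsuppOfBasisRight (M := V) b y i =
      TensorProduct.rid k V (LinearMap.lTensor V (b.coord i) y) := by
    intro y
    induction y with
    | zero => simp
    | add y z hy hz => simp [hy, hz]
    | tmul m n => simp
  rw [h1, h]
  rfl

theorem eq_zero_of_forall_rTensor_dual (x : V ⊗[k] W)
    (h : ∀ φ : V →ₗ[k] k, LinearMap.rTensor W φ x = 0) : x = 0 := by
  apply (TensorProduct.comm k V W).injective
  rw [map_zero]
  apply eq_zero_of_forall_lTensor_dual
  intro φ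
  have h1 : ∀ z : V ⊗[k] W, LinearMap.lTensor W φ (TensorProduct.comm k V W z) =
      TensorProduct.comm k k W (LinearMap.rTensor W φ z) := by
    intro z
    induction z with
    | zero => simp
    | add y z hy hz => simp only [map_add, hy, hz]
    | tmul m n => simp
  rw [h1, h φ, map_zero]

/-- Slicing `W` by a functional commutes with every `f i`, so the question reduces to vectors of
`V`. Applied to the multiplications of `A`, this allows cancellation in a single tensor leg. -/
theorem rTensor_jointly_injective {ι : Type*} (f : ι → V →ₗ[k] V')
    (hf : ∀ v, (∀ i, f i v = 0) → v = 0) {x y : V ⊗[k] W}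
    (h : ∀ i, LinearMap.rTensor W (f i) x = LinearMap.rTensor W (f i) y) : x = y := by
  rw [← sub_eq_zero]
  apply eq_zero_of_forall_lTensor_dual
  intro φ
  apply (TensorProduct.rid k V).injective
  rw [map_zero]
  apply hf
  intro i
  have h1 : f i (TensorProduct.rid k V (LinearMap.lTensor V φ (x - y))) =
      TensorProduct.rid k V' (LinearMap.lTensor V' φ (LinearMap.rTensor W (f i) (x - y))) := by
    induction (x - y) with
    | zero => simp
    | add y z hy hz => simp only [map_add, hy, hz]
    | tmul m n => simp
  rw [h1, map_sub, h i, sub_self, map_zero, map_zero]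

theorem lTensor_jointly_injective {ι : Type*} (f : ι → V →ₗ[k] V')
    (hf : ∀ v, (∀ i, f i v = 0) → v = 0) {x y : W ⊗[k] V}
    (h : ∀ i, LinearMap.lTensor W (f i) x = LinearMap.lTensor W (f i) y) : x = y := by
  apply (TensorProduct.comm k W V).injective
  apply rTensor_jointly_injective f hf
  intro i
  have h1 : ∀ z : W ⊗[k] V, LinearMap.rTensor W (f i) (TensorProduct.comm k W V z) =
      TensorProduct.comm k W V' (LinearMap.lTensor W (f i) z) := by
    intro z
    induction z with
    | zero => simp
    | add y z hy hz => simp only [map_add, hy, hz]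
    | tmul m n => simp
  rw [h1, h1, h i]

end TensorCancellation

/-! ### Slices and one-leg multiplications on `A ⊗ A`. -/

section LegMultiplication

variable {k : Type u} [Field k] {A : Type v}

section
variable [AddCommGroup A] [Module k A]

@[simp] theorem sliceL_tmul (ω : A →ₗ[k] k) (a b : A) : sliceL ω (a ⊗ₜ[k] b) = ω a • b := by
  simp [sliceL]

@[simp] theorem sliceR_tmul (ω : A →ₗ[k] k) (a b : A) : sliceR ω (a ⊗ₜ[k] b) = ω b • a := by
  simp [sliceR]

theorem apply_sliceL (ω η : A →ₗ[k] k) (x : A ⊗[k] A) : η (sliceL ω x) = ω (sliceR η x) := by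
  induction x with
  | zero => simp
  | add x y hx hy => simp only [map_add, hx, hy]
  | tmul a b => simp [mul_comm]

@[simp] theorem on23_tmul (f : A ⊗[k] A →ₗ[k] A ⊗[k] A) (a : A) (x : A ⊗[k] A) :
    on23 f (a ⊗ₜ[k] x) = a ⊗ₜ[k] f x := rfl

@[simp] theorem on12_tmul (f : A ⊗[k] A →ₗ[k] A ⊗[k] A) (a b c : A) :
    on12 f (a ⊗ₜ[k] (b ⊗ₜ[k] c)) = TensorProduct.assoc k A A A (f (a ⊗ₜ[k] b) ⊗ₜ[k] c) := rfl

@[simp] theorem onAct_apply (a : A) (p : MulPair k A) : onAct a p = p.2.unop a := rfl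

end

variable [NonUnitalRing A] [Module k A] [IsScalarTower k A A] [SMulCommClass k A A]

@[simp] theorem mulL1_tmul (a b c : A) : mulL1 (k := k) a (b ⊗ₜ[k] c) = (a * b) ⊗ₜ[k] c := rfl
@[simp] theorem mulL2_tmul (a b c : A) : mulL2 (k := k) a (b ⊗ₜ[k] c) = b ⊗ₜ[k] (a * c) := rfl
@[simp] theorem mulR1_tmul (a b c : A) : mulR1 (k := k) a (b ⊗ₜ[k] c) = (b * a) ⊗ₜ[k] c := rfl
@[simp] theorem mulR2_tmul (a b c : A) : mulR2 (k := k) a (b ⊗ₜ[k] c) = b ⊗ₜ[k] (c * a) := rfl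

theorem mulL1_mulL2 (a b : A) (x : A ⊗[k] A) : mulL1 a (mulL2 b x) = mulL2 b (mulL1 a x) := by
  induction x with
  | zero => simp
  | add x y hx hy => simp only [map_add, hx, hy]
  | tmul => simp

theorem mulR1_mulR2 (a b : A) (x : A ⊗[k] A) : mulR1 a (mulR2 b x) = mulR2 b (mulR1 a x) := by
  induction x with
  | zero => simp
  | add x y hx hy => simp only [map_add, hx, hy]
  | tmul => simp

theorem mulL1_mulR1 (a b : A) (x : A ⊗[k] A) : mulL1 a (mulR1 b x) = mulR1 b (mulL1 a x) := by
  induction x with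
  | zero => simp
  | add x y hx hy => simp only [map_add, hx, hy]
  | tmul => simp [mul_assoc]

theorem mulL1_mulR2 (a b : A) (x : A ⊗[k] A) : mulL1 a (mulR2 b x) = mulR2 b (mulL1 a x) := by
  induction x with
  | zero => simp
  | add x y hx hy => simp only [map_add, hx, hy]
  | tmul => simp

theorem mulL2_mulR1 (a b : A) (x : A ⊗[k] A) : mulL2 a (mulR1 b x) = mulR1 b (mulL2 a x) := by
  induction x with
  | zero => simp
  | add x y hx hy => simp only [map_add, hx, hy]
  | tmul => simp

theorem mulL2_mulR2 (a b : A) (x : A ⊗[k] A) : mulL2 a (mulR2 b x) = mulR2 b (mulL2 a x) := by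
  induction x with
  | zero => simp
  | add x y hx hy => simp only [map_add, hx, hy]
  | tmul => simp [mul_assoc]

theorem mulL1_mul (a b : A) (x : A ⊗[k] A) : mulL1 (a * b) x = mulL1 a (mulL1 b x) := by
  induction x with
  | zero => simp
  | add x y hx hy => simp only [map_add, hx, hy]
  | tmul => simp [mul_assoc]

theorem mulL2_mul (a b : A) (x : A ⊗[k] A) : mulL2 (a * b) x = mulL2 a (mulL2 b x) := by
  induction x with
  | zero => simp
  | add x y hx hy => simp only [map_add, hx, hy]
  | tmul => simp [mul_assoc]

theorem mulR1_mul (a b : A) (x : A ⊗[k] A) : mulR1 (a * b) x = mulR1 b (mulR1 a x) := by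
  induction x with
  | zero => simp
  | add x y hx hy => simp only [map_add, hx, hy]
  | tmul => simp [mul_assoc]

theorem mulR2_mul (a b : A) (x : A ⊗[k] A) : mulR2 (a * b) x = mulR2 b (mulR2 a x) := by
  induction x with
  | zero => simp
  | add x y hx hy => simp only [map_add, hx, hy]
  | tmul => simp [mul_assoc]

theorem tmul_mul_eq (a b : A) (x : A ⊗[k] A) : (a ⊗ₜ[k] b) * x = mulL1 a (mulL2 b x) := by
  induction x with
  | zero => simp
  | add x y hx hy => simp only [map_add, mul_add, hx, hy]
  | tmul => simp

theorem mul_tmul_eq (a b : A) (x : A ⊗[k] A) : x * (a ⊗ₜ[k] b) = mulR1 a (mulR2 b x) := by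
  induction x with
  | zero => simp
  | add x y hx hy => simp only [map_add, add_mul, hx, hy]
  | tmul => simp

theorem mulR1_mul_eq (a : A) (x y : A ⊗[k] A) : mulR1 a (x * y) = x * mulR1 a y := by
  induction y with
  | zero => simp
  | add y z hy hz => simp only [map_add, mul_add, hy, hz]
  | tmul b c => simp [mul_tmul_eq, mulR1_mulR2, mulR1_mul]

theorem mulR2_mul_eq (a : A) (x y : A ⊗[k] A) : mulR2 a (x * y) = x * mulR2 a y := by
  induction y with
  | zero => simp
  | add y z hy hz => simp only [map_add, mul_add, hy, hz]
  | tmul b c => simp [mul_tmul_eq, mulR1_mulR2, mulR2_mul]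

theorem mulL2_mul_eq (a : A) (x y : A ⊗[k] A) : mulL2 a (x * y) = mulL2 a x * y := by
  induction x with
  | zero => simp
  | add y z hy hz => simp only [map_add, add_mul, hy, hz]
  | tmul b c => simp [tmul_mul_eq, mulL2_mul, mulL1_mulL2]

@[simp] theorem sliceL_mulL2 (ω : A →ₗ[k] k) (a : A) (x : A ⊗[k] A) :
    sliceL ω (mulL2 a x) = a * sliceL ω x := by
  induction x with
  | zero => simp
  | add x y hx hy => simp only [map_add, mul_add, hx, hy]
  | tmul => simp [mul_smul_comm]

@[simp] theorem sliceL_mulR2 (ω : A →ₗ[k] k) (a : A) (x : A ⊗[k] A) :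
    sliceL ω (mulR2 a x) = sliceL ω x * a := by
  induction x with
  | zero => simp
  | add x y hx hy => simp only [map_add, add_mul, hx, hy]
  | tmul => simp [smul_mul_assoc]

@[simp] theorem sliceR_mulL1 (ω : A →ₗ[k] k) (a : A) (x : A ⊗[k] A) :
    sliceR ω (mulL1 a x) = a * sliceR ω x := by
  induction x with
  | zero => simp
  | add x y hx hy => simp only [map_add, mul_add, hx, hy]
  | tmul => simp [mul_smul_comm]

@[simp] theorem sliceR_mulR1 (ω : A →ₗ[k] k) (a : A) (x : A ⊗[k] A) :
    sliceR ω (mulR1 a x) = sliceR ω x * a := by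
  induction x with
  | zero => simp
  | add x y hx hy => simp only [map_add, add_mul, hx, hy]
  | tmul => simp [smul_mul_assoc]

end LegMultiplication

namespace RegularWMB

variable {k : Type u} [Field k] {A : Type v} [NonUnitalRing A] [Module k A]
  [IsScalarTower k A A] [SMulCommClass k A A]


/-! ### Non-degeneracy of `A` and of `A ⊗ A` as cancellation rules. -/

section Cancellation

theorem mulLeft_cancel (B : RegularWMB k A) {a b : A} (h : ∀ x : A, x * a = x * b) : a = b := by
  rw [← sub_eq_zero]
  exact B.nondeg_right _ fun x => by rw [mul_sub, h, sub_self]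

theorem mulRight_cancel (B : RegularWMB k A) {a b : A} (h : ∀ x : A, a * x = b * x) : a = b := by
  rw [← sub_eq_zero]
  exact B.nondeg_left _ fun x => by rw [sub_mul, h, sub_self]

variable {W : Type*} [AddCommGroup W] [Module k W]

theorem rTensor_mulLeft_cancel (B : RegularWMB k A) {x y : A ⊗[k] W}
    (h : ∀ a, LinearMap.rTensor W (LinearMap.mulLeft k a) x =
      LinearMap.rTensor W (LinearMap.mulLeft k a) y) : x = y :=
  rTensor_jointly_injective (V := A) (V' := A) (ι := A) (LinearMap.mulLeft k) B.nondeg_right h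

theorem rTensor_mulRight_cancel (B : RegularWMB k A) {x y : A ⊗[k] W}
    (h : ∀ a, LinearMap.rTensor W (LinearMap.mulRight k a) x =
      LinearMap.rTensor W (LinearMap.mulRight k a) y) : x = y :=
  rTensor_jointly_injective (V := A) (V' := A) (ι := A) (LinearMap.mulRight k) B.nondeg_left h

theorem mulL1_cancel (B : RegularWMB k A) {x y : A ⊗[k] A} (h : ∀ a, mulL1 a x = mulL1 a y) : x = y :=
  B.rTensor_mulLeft_cancel h

theorem mulR1_cancel (B : RegularWMB k A) {x y : A ⊗[k] A} (h : ∀ a, mulR1 a x = mulR1 a y) : x = y :=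
  B.rTensor_mulRight_cancel h

theorem mulL2_cancel (B : RegularWMB k A) {x y : A ⊗[k] A} (h : ∀ a, mulL2 a x = mulL2 a y) : x = y :=
  lTensor_jointly_injective (V := A) (V' := A) (ι := A) (LinearMap.mulLeft k) B.nondeg_right h

theorem mulR2_cancel (B : RegularWMB k A) {x y : A ⊗[k] A} (h : ∀ a, mulR2 a x = mulR2 a y) : x = y :=
  lTensor_jointly_injective (V := A) (V' := A) (ι := A) (LinearMap.mulRight k) B.nondeg_left h

theorem tensor_mulLeft_cancel (B : RegularWMB k A) {x y : A ⊗[k] A} (h : ∀ z : A ⊗[k] A, z * x = z * y) : x = y :=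
  B.mulL2_cancel fun b => B.mulL1_cancel fun a => by
    rw [← tmul_mul_eq, ← tmul_mul_eq, h]

theorem tensor_mulRight_cancel (B : RegularWMB k A) {x y : A ⊗[k] A} (h : ∀ z : A ⊗[k] A, x * z = y * z) : x = y :=
  B.mulR2_cancel fun b => B.mulR1_cancel fun a => by
    rw [← mul_tmul_eq, ← mul_tmul_eq, h]

/-- A property of elements of `A` that is additive and holds for products holds everywhere. -/
theorem induction_on_mul (B : RegularWMB k A) {p : A → Prop} (a : A) (h0 : p 0) (hadd : ∀ x y, p x → p y → p (x + y))
    (hmul : ∀ x y, p (x * y)) : p a := by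
  obtain ⟨x, rfl⟩ := B.idempotent a
  induction x with
  | zero => simpa using h0
  | add x y hx hy => rw [map_add]; exact hadd _ _ hx hy
  | tmul x y => exact hmul x y

end Cancellation

/-! ### The idempotent multiplier E and the counit laws. -/

variable (B : RegularWMB k A)

theorem mul_E₁ (x y : A ⊗[k] A) : x * B.E₁ y = B.E₂ x * y := by
  induction x with
  | zero => simp
  | add x x' hx hx' => simp only [map_add, add_mul, hx, hx']
  | tmul a b =>
    induction y with
    | zero => simp
    | add y y' hy hy' => simp only [map_add, mul_add, hy, hy']
    | tmul c d => exact B.E_compat a b c d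

/-- The left part of a multiplier on a non-degenerate algebra commutes with right multiplication. -/
theorem E₁_mulR1 (a : A) (x : A ⊗[k] A) : B.E₁ (mulR1 a x) = mulR1 a (B.E₁ x) :=
  B.tensor_mulLeft_cancel fun z => by rw [mul_E₁, ← mulR1_mul_eq, ← mulR1_mul_eq, mul_E₁]

theorem E₁_mulR2 (a : A) (x : A ⊗[k] A) : B.E₁ (mulR2 a x) = mulR2 a (B.E₁ x) :=
  B.tensor_mulLeft_cancel fun z => by rw [mul_E₁, ← mulR2_mul_eq, ← mulR2_mul_eq, mul_E₁]


theorem E₂_mulL2 (a : A) (x : A ⊗[k] A) : B.E₂ (mulL2 a x) = mulL2 a (B.E₂ x) :=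
  B.tensor_mulRight_cancel fun z => by rw [← mul_E₁, ← mulL2_mul_eq, ← mulL2_mul_eq, mul_E₁]

theorem E₁_E₁ (x : A ⊗[k] A) : B.E₁ (B.E₁ x) = B.E₁ x := LinearMap.congr_fun B.E_idem x

theorem E₂_E₂ (x : A ⊗[k] A) : B.E₂ (B.E₂ x) = B.E₂ x :=
  B.tensor_mulRight_cancel fun z => by rw [← mul_E₁, ← mul_E₁, E₁_E₁, mul_E₁]

theorem sliceL_T₁ (a b : A) : sliceL B.counit (B.T₁ (a ⊗ₜ[k] b)) = a * b := by
  simpa using LinearMap.congr_fun B.counit_T₁ (a ⊗ₜ[k] b)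

theorem sliceR_T₂ (a b : A) : sliceR B.counit (B.T₂ (a ⊗ₜ[k] b)) = a * b := by
  simpa using LinearMap.congr_fun B.counit_T₂ (a ⊗ₜ[k] b)

theorem coassoc_apply (a b c : A) : on12 B.T₂ (a ⊗ₜ[k] B.T₁ (b ⊗ₜ[k] c)) =
    on23 B.T₁ (TensorProduct.assoc k A A A (B.T₂ (a ⊗ₜ[k] b) ⊗ₜ[k] c)) := by
  simpa using LinearMap.congr_fun B.coassoc (a ⊗ₜ[k] (b ⊗ₜ[k] c))

/-! ### Relations between the four canonical maps -/

/-- Both sides are (a ⊗ 1)Δ(b)(1 ⊗ c). They come from coassociativity by applying ε to the middle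
leg, where one side meets the counit law of T₂ and the other that of T₁. -/
theorem mulL1_T₁ (a b c : A) :
    mulL1 a (B.T₁ (b ⊗ₜ[k] c)) = mulR2 c (B.T₂ (a ⊗ₜ[k] b)) := by
  have h := congrArg (LinearMap.lTensor A (sliceL B.counit)) (B.coassoc_apply a b c)
  have h1 : ∀ t : A ⊗[k] A, LinearMap.lTensor A (sliceL B.counit) (on12 B.T₂ (a ⊗ₜ[k] t)) =
      mulL1 a t := by
    intro t
    induction t with
    | zero => simp
    | add x y hx hy => simp only [map_add, TensorProduct.tmul_add, hx, hy]
    | tmul b c =>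
      have h2 : ∀ s : A ⊗[k] A, LinearMap.lTensor A (sliceL B.counit)
          (TensorProduct.assoc k A A A (s ⊗ₜ[k] c)) = sliceR B.counit s ⊗ₜ[k] c := by
        intro s
        induction s with
        | zero => simp
        | add x y hx hy => simp only [map_add, TensorProduct.add_tmul, hx, hy]
        | tmul => simp [TensorProduct.smul_tmul]
      simp [h2, sliceR_T₂]
  have h3 : ∀ s : A ⊗[k] A, LinearMap.lTensor A (sliceL B.counit)
      (on23 B.T₁ (TensorProduct.assoc k A A A (s ⊗ₜ[k] c))) = mulR2 c s := by
    intro s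
    induction s with
    | zero => simp
    | add x y hx hy => simp only [map_add, TensorProduct.add_tmul, hx, hy]
    | tmul => simp [sliceL_T₁]
  rwa [h1, h3] at h

theorem mulL2_T₂ (a y d : A) :
    mulL2 a (B.T₂ (y ⊗ₜ[k] d)) = mulL1 y (B.T₃ (d ⊗ₜ[k] a)) :=
  B.mulR2_cancel fun x => by
    rw [← mulL2_mulR2, ← mulL1_T₁, ← mulL1_mulL2, B.T₁_T₃, mulL1_mulR2]

theorem mulR1_T₁ (a b c : A) :
    mulR1 b (B.T₁ (a ⊗ₜ[k] c)) = mulR2 c (B.T₄ (b ⊗ₜ[k] a)) :=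
  B.mulL1_cancel fun y => by
    rw [mulL1_mulR1, mulL1_T₁, mulR1_mulR2, B.T₂_T₄, mulL1_mulR2]

theorem mulL2_T₄ (a s q : A) :
    mulL2 a (B.T₄ (s ⊗ₜ[k] q)) = mulR1 s (B.T₃ (q ⊗ₜ[k] a)) :=
  B.mulR2_cancel fun x => by
    rw [← mulL2_mulR2, ← mulR1_T₁, mulL2_mulR1, B.T₁_T₃, mulR1_mulR2]

theorem sliceL_T₃ (a b : A) : sliceL B.counit (B.T₃ (a ⊗ₜ[k] b)) = b * a :=
  B.mulRight_cancel fun x => by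
    rw [← sliceL_mulR2, ← B.T₁_T₃, sliceL_mulL2, sliceL_T₁, mul_assoc]

theorem sliceR_T₄ (a b : A) : sliceR B.counit (B.T₄ (a ⊗ₜ[k] b)) = b * a :=
  B.mulLeft_cancel fun x => by
    rw [← sliceR_mulL1, ← B.T₂_T₄, sliceR_mulR1, sliceR_T₂, mul_assoc]

/-- This is EΔ(a) = Δ(a). After multiplication by c ⊗ 1 on the right the element lies in the range
of E₁ by the span axiom, and E₁ is idempotent. -/
theorem E₁_T₁_apply (a b : A) : B.E₁ (B.T₁ (a ⊗ₜ[k] b)) = B.T₁ (a ⊗ₜ[k] b) := by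
  refine B.mulR1_cancel fun c => ?_
  rw [← E₁_mulR1]
  have h : mulR1 c (B.T₁ (a ⊗ₜ[k] b)) ∈
      Submodule.span k {x | ∃ b c : A, x = B.E₁ (b ⊗ₜ[k] c)} := by
    rw [← B.span_E₁]
    exact Submodule.subset_span ⟨a, c, b, rfl⟩
  generalize mulR1 c (B.T₁ (a ⊗ₜ[k] b)) = x at h ⊢
  induction h using Submodule.span_induction with
  | mem x h => obtain ⟨b, c, rfl⟩ := h; exact B.E₁_E₁ _
  | zero => simp
  | add x y _ _ hx hy => rw [map_add, hx, hy]
  | smul c x _ hx => rw [map_smul, hx]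

theorem E₂_T₂_apply (a b : A) : B.E₂ (B.T₂ (a ⊗ₜ[k] b)) = B.T₂ (a ⊗ₜ[k] b) := by
  refine B.mulL2_cancel fun c => ?_
  rw [← E₂_mulL2]
  have h : mulL2 c (B.T₂ (a ⊗ₜ[k] b)) ∈
      Submodule.span k {x | ∃ b c : A, x = B.E₂ (b ⊗ₜ[k] c)} := by
    rw [← B.span_E₂]
    exact Submodule.subset_span ⟨b, a, c, rfl⟩
  generalize mulL2 c (B.T₂ (a ⊗ₜ[k] b)) = x at h ⊢
  induction h using Submodule.span_induction with
  | mem x h => obtain ⟨b, c, rfl⟩ := h; exact B.E₂_E₂ _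
  | zero => simp
  | add x y _ _ hx hy => rw [map_add, hx, hy]
  | smul c x _ hx => rw [map_smul, hx]

theorem E₁_T₄_apply (a b : A) : B.E₁ (B.T₄ (a ⊗ₜ[k] b)) = B.T₄ (a ⊗ₜ[k] b) :=
  B.mulR2_cancel fun c => by rw [← E₁_mulR2, ← mulR1_T₁, E₁_mulR1, E₁_T₁_apply]


/-! ### The comultiplication as a multiplier on `A ⊗ A` -/

/-- The left action `x ↦ Δ(d) x` of the comultiplication of `d` on `A ⊗ A`. -/
def comulL (d : A) : A ⊗[k] A →ₗ[k] A ⊗[k] A :=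
  LinearMap.lTensor A (LinearMap.mul' k A) ∘ₗ (TensorProduct.assoc k A A A).toLinearMap ∘ₗ
    LinearMap.rTensor A (B.T₄ ∘ₗ (TensorProduct.mk k A A).flip d)

/-- The right action `x ↦ x Δ(d)` of the comultiplication of `d` on `A ⊗ A`. -/
def comulR (d : A) : A ⊗[k] A →ₗ[k] A ⊗[k] A :=
  LinearMap.lTensor A (LinearMap.mul' k A ∘ₗ (TensorProduct.comm k A A).toLinearMap) ∘ₗ
    (TensorProduct.assoc k A A A).toLinearMap ∘ₗ
    LinearMap.rTensor A (B.T₂ ∘ₗ (TensorProduct.mk k A A).flip d)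

theorem comulL_tmul (d p u : A) : B.comulL d (p ⊗ₜ[k] u) = mulR2 u (B.T₄ (p ⊗ₜ[k] d)) := by
  have h : ∀ t : A ⊗[k] A, LinearMap.lTensor A (LinearMap.mul' k A)
      (TensorProduct.assoc k A A A (t ⊗ₜ[k] u)) = mulR2 u t := by
    intro t
    induction t with
    | zero => simp
    | add x y hx hy => simp only [TensorProduct.add_tmul, map_add, hx, hy]
    | tmul => simp
  simp [comulL, h]

theorem comulR_tmul (d p u : A) : B.comulR d (p ⊗ₜ[k] u) = mulL2 u (B.T₂ (p ⊗ₜ[k] d)) := by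
  have h : ∀ t : A ⊗[k] A, LinearMap.lTensor A
      (LinearMap.mul' k A ∘ₗ (TensorProduct.comm k A A).toLinearMap)
      (TensorProduct.assoc k A A A (t ⊗ₜ[k] u)) = mulL2 u t := by
    intro t
    induction t with
    | zero => simp
    | add x y hx hy => simp only [TensorProduct.add_tmul, map_add, hx, hy]
    | tmul => simp
  simp [comulR, h]

theorem comulR_mul (d : A) (x y : A ⊗[k] A) : B.comulR d x * y = x * B.comulL d y := by
  induction x with
  | zero => simp
  | add x x' hx hx' => simp only [map_add, add_mul, hx, hx']
  | tmul p u =>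
    induction y with
    | zero => simp
    | add y y' hy hy' => simp only [map_add, mul_add, hy, hy']
    | tmul q v =>
      rw [comulR_tmul, comulL_tmul, mul_tmul_eq, tmul_mul_eq, ← mulL2_mulR2, ← mulL2_mulR1,
        mulR1_mulR2, B.T₂_T₄, mulL1_mulL2, mulL1_mulR2]

theorem comulL_mulR1 (d a : A) (x : A ⊗[k] A) :
    B.comulL d (mulR1 a x) = mulR1 a (B.comulL d x) :=
  B.tensor_mulLeft_cancel fun z => by
    rw [← comulR_mul, ← mulR1_mul_eq, ← mulR1_mul_eq, comulR_mul]

theorem comulL_mulR2 (d a : A) (x : A ⊗[k] A) :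
    B.comulL d (mulR2 a x) = mulR2 a (B.comulL d x) :=
  B.tensor_mulLeft_cancel fun z => by
    rw [← comulR_mul, ← mulR2_mul_eq, ← mulR2_mul_eq, comulR_mul]


theorem E₁_comulL (d : A) (x : A ⊗[k] A) : B.E₁ (B.comulL d x) = B.comulL d x := by
  induction x with
  | zero => simp
  | add x y hx hy => simp only [map_add, hx, hy]
  | tmul p u => rw [comulL_tmul, E₁_mulR2, E₁_T₄_apply]

theorem E₂_comulR (d : A) (x : A ⊗[k] A) : B.E₂ (B.comulR d x) = B.comulR d x := by
  induction x with
  | zero => simp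
  | add x y hx hy => simp only [map_add, hx, hy]
  | tmul p u => rw [comulR_tmul, E₂_mulL2, E₂_T₂_apply]

/-- Again EΔ(d) = Δ(d), now read from the right action: multiplying by z moves everything to the
left action, where it is known. -/
theorem comulR_E₂ (d : A) (x : A ⊗[k] A) : B.comulR d (B.E₂ x) = B.comulR d x :=
  B.tensor_mulRight_cancel fun z => by rw [comulR_mul, ← mul_E₁, E₁_comulL, comulR_mul]

theorem comulL_E₁ (d : A) (x : A ⊗[k] A) : B.comulL d (B.E₁ x) = B.comulL d x :=
  B.tensor_mulLeft_cancel fun z => by rw [← comulR_mul, mul_E₁, E₂_comulR, comulR_mul]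

/-- The axiom on T₁ and μ is the multiplicativity of Δ: with a in the first leg and p ⊗ q in the
others, T₁ on legs 1 and 3 followed by μ gives Δ(a)(p ⊗ q). -/
theorem T₁_mul_apply (a b c : A) :
    B.T₁ ((a * b) ⊗ₜ[k] c) = B.comulL a (B.T₁ (b ⊗ₜ[k] c)) := by
  have h := LinearMap.congr_fun B.T₁_mul (a ⊗ₜ[k] (b ⊗ₜ[k] c))
  have h1 : ∀ p : A, ∀ s : A ⊗[k] A, mu12 k A (LinearMap.lTensor A
      (TensorProduct.comm k A A).toLinearMap (TensorProduct.assoc k A A A (s ⊗ₜ[k] p))) =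
      mulR1 p s := by
    intro p s
    induction s with
    | zero => simp
    | add x y hx hy => simp only [TensorProduct.add_tmul, map_add, hx, hy]
    | tmul => simp [mu12]
  have h2 : ∀ t : A ⊗[k] A, mu12 k A (on13 B.T₁ (a ⊗ₜ[k] t)) = B.comulL a t := by
    intro t
    induction t with
    | zero => simp
    | add x y hx hy => simp only [TensorProduct.tmul_add, map_add, hx, hy]
    | tmul p q => rw [comulL_tmul, ← mulR1_T₁, ← h1]; simp [on13]
  have h3 : mu12 k A (a ⊗ₜ[k] (b ⊗ₜ[k] c)) = (a * b) ⊗ₜ[k] c := by simp [mu12]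
  simp only [LinearMap.comp_apply, on23_tmul, h2, h3] at h
  exact h.symm

theorem T₄_mul_apply (x a b : A) :
    B.T₄ (x ⊗ₜ[k] (a * b)) = B.comulL a (B.T₄ (x ⊗ₜ[k] b)) :=
  B.mulR2_cancel fun c => by
    rw [← mulR1_T₁, T₁_mul_apply, ← comulL_mulR1, mulR1_T₁, comulL_mulR2]

theorem comulL_comulL (a b : A) (x : A ⊗[k] A) :
    B.comulL (a * b) x = B.comulL a (B.comulL b x) := by
  induction x with
  | zero => simp
  | add x y hx hy => simp only [map_add, hx, hy]
  | tmul p u => rw [comulL_tmul, T₄_mul_apply, comulL_tmul, comulL_mulR2]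

theorem T₂_mul_eq (x b : A) (y : A ⊗[k] A) :
    B.T₂ (x ⊗ₜ[k] b) * y = mulL1 x (B.comulL b y) := by
  induction y with
  | zero => simp
  | add y y' hy hy' => simp only [map_add, mul_add, hy, hy']
  | tmul u v => rw [mul_tmul_eq, comulL_tmul, mulR1_mulR2, B.T₂_T₄, mulL1_mulR2]

theorem T₂_mul_apply (x a b : A) :
    B.T₂ (x ⊗ₜ[k] (a * b)) = B.comulR b (B.T₂ (x ⊗ₜ[k] a)) :=
  B.tensor_mulRight_cancel fun z => by
    rw [T₂_mul_eq, comulL_comulL, comulR_mul, T₂_mul_eq]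

/-! ### Coassociativity in terms of `T₄` and `T₃` -/

theorem rTensor_mulLeft_assoc (y : A) (t : A ⊗[k] A) (c : A) :
    LinearMap.rTensor (A ⊗[k] A) (LinearMap.mulLeft k y)
      (TensorProduct.assoc k A A A (t ⊗ₜ[k] c)) =
    TensorProduct.assoc k A A A (mulL1 y t ⊗ₜ[k] c) := by
  induction t with
  | zero => simp
  | add x y hx hy => simp only [TensorProduct.add_tmul, map_add, hx, hy]
  | tmul => simp

theorem rTensor_mulRight_assoc (y : A) (t : A ⊗[k] A) (c : A) :
    LinearMap.rTensor (A ⊗[k] A) (LinearMap.mulRight k y)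
      (TensorProduct.assoc k A A A (t ⊗ₜ[k] c)) =
    TensorProduct.assoc k A A A (mulR1 y t ⊗ₜ[k] c) := by
  induction t with
  | zero => simp
  | add x y hx hy => simp only [TensorProduct.add_tmul, map_add, hx, hy]
  | tmul => simp

theorem lTensor_mulL2_assoc (y : A) (t : A ⊗[k] A) (c : A) :
    LinearMap.lTensor A (mulL2 y) (TensorProduct.assoc k A A A (t ⊗ₜ[k] c)) =
    TensorProduct.assoc k A A A (t ⊗ₜ[k] (y * c)) := by
  induction t with
  | zero => simp
  | add x y hx hy => simp only [TensorProduct.add_tmul, map_add, hx, hy]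
  | tmul => simp

theorem lTensor_mulR2_assoc (y : A) (t : A ⊗[k] A) (c : A) :
    LinearMap.lTensor A (mulR2 y) (TensorProduct.assoc k A A A (t ⊗ₜ[k] c)) =
    TensorProduct.assoc k A A A (t ⊗ₜ[k] (c * y)) := by
  induction t with
  | zero => simp
  | add x y hx hy => simp only [TensorProduct.add_tmul, map_add, hx, hy]
  | tmul => simp

theorem lTensor_mulL1_assoc (y : A) (t : A ⊗[k] A) (c : A) :
    LinearMap.lTensor A (mulL1 y) (TensorProduct.assoc k A A A (t ⊗ₜ[k] c)) =
    TensorProduct.assoc k A A A (mulL2 y t ⊗ₜ[k] c) := by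
  induction t with
  | zero => simp
  | add x y hx hy => simp only [TensorProduct.add_tmul, map_add, hx, hy]
  | tmul => simp

theorem lTensor_mulL2_on12 (f : A ⊗[k] A →ₗ[k] A ⊗[k] A) (x y : A) (t : A ⊗[k] A) :
    LinearMap.lTensor A (mulL2 y) (on12 f (x ⊗ₜ[k] t)) = on12 f (x ⊗ₜ[k] mulL2 y t) := by
  induction t with
  | zero => simp
  | add x y hx hy => simp only [TensorProduct.tmul_add, map_add, hx, hy]
  | tmul => simp [lTensor_mulL2_assoc]

theorem lTensor_mulR2_on12 (f : A ⊗[k] A →ₗ[k] A ⊗[k] A) (x y : A) (t : A ⊗[k] A) :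
    LinearMap.lTensor A (mulR2 y) (on12 f (x ⊗ₜ[k] t)) = on12 f (x ⊗ₜ[k] mulR2 y t) := by
  induction t with
  | zero => simp
  | add x y hx hy => simp only [TensorProduct.tmul_add, map_add, hx, hy]
  | tmul => simp [lTensor_mulR2_assoc]


theorem lTensor_mulL1_cancel {x y : A ⊗[k] (A ⊗[k] A)} (B : RegularWMB k A)
    (h : ∀ a, LinearMap.lTensor A (mulL1 a) x = LinearMap.lTensor A (mulL1 a) y) : x = y :=
  lTensor_jointly_injective (V := A ⊗[k] A) (V' := A ⊗[k] A) (ι := A) (fun a => mulL1 a)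
    (fun v hv => B.mulL1_cancel fun a => by rw [hv, map_zero]) h

theorem lTensor_mulR2_cancel {x y : A ⊗[k] (A ⊗[k] A)} (B : RegularWMB k A)
    (h : ∀ a, LinearMap.lTensor A (mulR2 a) x = LinearMap.lTensor A (mulR2 a) y) : x = y :=
  lTensor_jointly_injective (V := A ⊗[k] A) (V' := A ⊗[k] A) (ι := A) (fun a => mulR2 a)
    (fun v hv => B.mulR2_cancel fun a => by rw [hv, map_zero]) h

theorem lTensor_mulR2_on23_T₃ (x : A) (t : A ⊗[k] A) (c : A) :
    LinearMap.lTensor A (mulR2 x) (on23 B.T₃ (TensorProduct.assoc k A A A (t ⊗ₜ[k] c))) =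
    LinearMap.lTensor A (mulL2 c) (on23 B.T₁ (TensorProduct.assoc k A A A (t ⊗ₜ[k] x))) := by
  induction t with
  | zero => simp
  | add x y hx hy => simp only [TensorProduct.add_tmul, map_add, hx, hy]
  | tmul => simp [B.T₁_T₃]

/-- Coassociativity, with the third leg multiplied from the left. -/
theorem coassoc_T₂_T₃ (a b c : A) : on12 B.T₂ (a ⊗ₜ[k] B.T₃ (b ⊗ₜ[k] c)) =
    on23 B.T₃ (TensorProduct.assoc k A A A (B.T₂ (a ⊗ₜ[k] b) ⊗ₜ[k] c)) :=
  B.lTensor_mulR2_cancel fun x => by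
    rw [lTensor_mulR2_on23_T₃, lTensor_mulR2_on12, ← B.T₁_T₃, ← lTensor_mulL2_on12,
      coassoc_apply]

theorem rTensor_mulLeft_on12_T₄ (a x : A) (t : A ⊗[k] A) :
    LinearMap.rTensor (A ⊗[k] A) (LinearMap.mulLeft k a) (on12 B.T₄ (x ⊗ₜ[k] t)) =
    LinearMap.rTensor (A ⊗[k] A) (LinearMap.mulRight k x) (on12 B.T₂ (a ⊗ₜ[k] t)) := by
  induction t with
  | zero => simp
  | add x y hx hy => simp only [TensorProduct.tmul_add, map_add, hx, hy]
  | tmul => simp [rTensor_mulLeft_assoc, rTensor_mulRight_assoc, B.T₂_T₄]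

theorem rTensor_on23 (g : A →ₗ[k] A) (f : A ⊗[k] A →ₗ[k] A ⊗[k] A) (t : A ⊗[k] (A ⊗[k] A)) :
    LinearMap.rTensor (A ⊗[k] A) g (on23 f t) = on23 f (LinearMap.rTensor (A ⊗[k] A) g t) := by
  induction t with
  | zero => simp
  | add x y hx hy => simp only [map_add, hx, hy]
  | tmul => simp

/-- Coassociativity, with the first leg multiplied from the right and the third from the left. -/
theorem coassoc_T₄_T₃ (a b c : A) : on12 B.T₄ (a ⊗ₜ[k] B.T₃ (b ⊗ₜ[k] c)) =
    on23 B.T₃ (TensorProduct.assoc k A A A (B.T₄ (a ⊗ₜ[k] b) ⊗ₜ[k] c)) :=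
  B.rTensor_mulLeft_cancel fun x => by
    rw [rTensor_mulLeft_on12_T₄, coassoc_T₂_T₃, rTensor_on23, rTensor_on23,
      rTensor_mulLeft_assoc, rTensor_mulRight_assoc, B.T₂_T₄]

theorem E₁_T₁_coassoc (x a c : A) : on12 B.E₁ (x ⊗ₜ[k] B.T₁ (a ⊗ₜ[k] c)) =
    on23 B.T₁ (TensorProduct.assoc k A A A (B.E₁ (x ⊗ₜ[k] a) ⊗ₜ[k] c)) := by
  simpa using LinearMap.congr_fun B.E₁_T₁ (x ⊗ₜ[k] (a ⊗ₜ[k] c))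

/-- The axiom relating E₂ to T₂ after multiplying by c on the left of the third leg; the factor y on
the middle leg, built into T₂, is then cancelled. -/
theorem E₂_T₃_coassoc (x a c : A) : on12 B.E₂ (x ⊗ₜ[k] B.T₃ (a ⊗ₜ[k] c)) =
    on23 B.T₃ (TensorProduct.assoc k A A A (B.E₂ (x ⊗ₜ[k] a) ⊗ₜ[k] c)) := by
  refine B.lTensor_mulL1_cancel fun y => ?_
  have h := LinearMap.congr_fun B.E₂_T₂ (x ⊗ₜ[k] (y ⊗ₜ[k] a))
  have h1 : ∀ t : A ⊗[k] A, LinearMap.lTensor A (mulL1 y) (on12 B.E₂ (x ⊗ₜ[k] t)) =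
      on12 B.E₂ (x ⊗ₜ[k] mulL1 y t) := by
    intro t
    induction t with
    | zero => simp
    | add x y hx hy => simp only [TensorProduct.tmul_add, map_add, hx, hy]
    | tmul => simp [lTensor_mulL1_assoc, ← E₂_mulL2]
  have h2 : ∀ t : A ⊗[k] A, LinearMap.lTensor A (mulL1 y)
      (on23 B.T₃ (TensorProduct.assoc k A A A (t ⊗ₜ[k] c))) =
      LinearMap.lTensor A (mulL2 c) (on23 B.T₂ (LinearMap.lTensor A
        (TensorProduct.comm k A A).toLinearMap (TensorProduct.assoc k A A A (t ⊗ₜ[k] y)))) := by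
    intro t
    induction t with
    | zero => simp
    | add x y hx hy => simp only [TensorProduct.add_tmul, map_add, hx, hy]
    | tmul => simp [mulL2_T₂]
  rw [h1, h2, ← mulL2_T₂, ← lTensor_mulL2_on12]
  exact congrArg (LinearMap.lTensor A (mulL2 c)) h

end RegularWMB
end WMB

namespace WMB

/-! ### Exchanging two summations inside a slice. -/

section
variable {k : Type u} [Field k] {A : Type v} [NonUnitalRing A] [Module k A]
  [IsScalarTower k A A] [SMulCommClass k A A]

/-- For t = t₁ ⊗ t₂ and v = v₁ ⊗ v₂, both sides are ω(v₁ t₂) t₁ ⊗ v₂; only the order of the two sums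
differs. -/
theorem lTensor_sliceL_mulR1 (ω : A →ₗ[k] k) (t v : A ⊗[k] A) (f g : A →ₗ[k] A)
    (hf : ∀ s, f s = sliceL ω (mulR1 s v)) (hg : ∀ u, g u = sliceR ω (mulL2 u t)) :
    LinearMap.lTensor A f t = LinearMap.rTensor A g v := by
  obtain ⟨S, rfl⟩ := TensorProduct.exists_finset t
  obtain ⟨S', rfl⟩ := TensorProduct.exists_finset v
  simp only [map_sum, LinearMap.lTensor_tmul, LinearMap.rTensor_tmul, hf, hg, mulR1_tmul,
    mulL2_tmul, sliceL_tmul, sliceR_tmul, TensorProduct.tmul_sum, TensorProduct.sum_tmul,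
    TensorProduct.smul_tmul]
  exact Finset.sum_comm

theorem lTensor_sliceL_mulL1 (ω : A →ₗ[k] k) (t v : A ⊗[k] A) (f g : A →ₗ[k] A)
    (hf : ∀ s, f s = sliceL ω (mulL1 s v)) (hg : ∀ u, g u = sliceR ω (mulR2 u t)) :
    LinearMap.lTensor A f t = LinearMap.rTensor A g v := by
  obtain ⟨S, rfl⟩ := TensorProduct.exists_finset t
  obtain ⟨S', rfl⟩ := TensorProduct.exists_finset v
  simp only [map_sum, LinearMap.lTensor_tmul, LinearMap.rTensor_tmul, hf, hg, mulL1_tmul,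
    mulR2_tmul, sliceL_tmul, sliceR_tmul, TensorProduct.tmul_sum, TensorProduct.sum_tmul,
    TensorProduct.smul_tmul]
  exact Finset.sum_comm

theorem mulL2_lTensor (a : A) (f : A →ₗ[k] A) (t : A ⊗[k] A) :
    mulL2 a (LinearMap.lTensor A f t) = LinearMap.lTensor A (LinearMap.mulLeft k a ∘ₗ f) t := by
  rw [LinearMap.lTensor_comp]; rfl

theorem mulR2_lTensor (a : A) (f : A →ₗ[k] A) (t : A ⊗[k] A) :
    mulR2 a (LinearMap.lTensor A f t) = LinearMap.lTensor A (LinearMap.mulRight k a ∘ₗ f) t := by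
  rw [LinearMap.lTensor_comp]; rfl

theorem lTensor_comp_assoc_tmul (f : A ⊗[k] A →ₗ[k] A) (t : A ⊗[k] A) (q : A) :
    LinearMap.lTensor A f (TensorProduct.assoc k A A A (t ⊗ₜ[k] q)) =
      LinearMap.lTensor A (f ∘ₗ (TensorProduct.mk k A A).flip q) t := by
  induction t with
  | zero => simp
  | add x y hx hy => simp only [TensorProduct.add_tmul, map_add, hx, hy]
  | tmul => simp

theorem rTensor_comp_assoc_symm_tmul (f : A ⊗[k] A →ₗ[k] A) (t : A ⊗[k] A) (p : A) :
    LinearMap.rTensor A f ((TensorProduct.assoc k A A A).symm (p ⊗ₜ[k] t)) =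
      LinearMap.rTensor A (f ∘ₗ TensorProduct.mk k A A p) t := by
  induction t with
  | zero => simp
  | add x y hx hy => simp only [TensorProduct.tmul_add, map_add, hx, hy]
  | tmul => simp

end

namespace RegularWMB

variable {k : Type u} [Field k] {A : Type v} [NonUnitalRing A] [Module k A]
  [IsScalarTower k A A] [SMulCommClass k A A] (B : RegularWMB k A)

/-! ### `⊓ᴿ(a)` is a multiplier -/

/-- The map `y ⊗ a ↦ y d₁ ⊗ ε(a₁ d₂) a₂`. -/
def counitTwistR (d : A) : A ⊗[k] A →ₗ[k] A ⊗[k] A :=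
  LinearMap.lTensor A (sliceL B.counit ∘ₗ B.T₄) ∘ₗ (TensorProduct.assoc k A A A).toLinearMap ∘ₗ
    LinearMap.rTensor A (B.T₂ ∘ₗ (TensorProduct.mk k A A).flip d)

/-- The map `p ⊗ u ⊗ w ↦ p d₁ ε(u d₂) ⊗ w`. -/
def counitSliceR (d : A) : A ⊗[k] (A ⊗[k] A) →ₗ[k] A ⊗[k] A :=
  LinearMap.rTensor A (sliceR B.counit ∘ₗ B.comulR d) ∘ₗ
    (TensorProduct.assoc k A A A).symm.toLinearMap

theorem counitTwistR_tmul (d p q : A) : B.counitTwistR d (p ⊗ₜ[k] q) =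
    LinearMap.lTensor A (sliceL B.counit ∘ₗ B.T₄ ∘ₗ (TensorProduct.mk k A A).flip q)
      (B.T₂ (p ⊗ₜ[k] d)) := by
  simp only [counitTwistR, LinearMap.comp_apply, LinearMap.rTensor_tmul, LinearMap.flip_apply,
    TensorProduct.mk_apply, LinearEquiv.coe_coe, lTensor_comp_assoc_tmul, LinearMap.comp_assoc]

theorem counitSliceR_tmul (d p : A) (v : A ⊗[k] A) : B.counitSliceR d (p ⊗ₜ[k] v) =
    LinearMap.rTensor A (sliceR B.counit ∘ₗ B.comulR d ∘ₗ TensorProduct.mk k A A p) v := by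
  simp only [counitSliceR, LinearMap.comp_apply, LinearEquiv.coe_coe,
    rTensor_comp_assoc_symm_tmul, LinearMap.comp_assoc]

theorem counitSliceR_assoc (d w : A) (x : A ⊗[k] A) :
    B.counitSliceR d (TensorProduct.assoc k A A A (x ⊗ₜ[k] w)) =
      sliceR B.counit (B.comulR d x) ⊗ₜ[k] w := by
  simp [counitSliceR]

theorem mulR2_counitTwistR (d p q c : A) : mulR2 c (B.counitTwistR d (p ⊗ₜ[k] q)) =
    B.counitSliceR d (p ⊗ₜ[k] B.T₁ (q ⊗ₜ[k] c)) := by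
  rw [counitTwistR_tmul, mulR2_lTensor, counitSliceR_tmul]
  apply lTensor_sliceL_mulR1 B.counit
  · intro s
    simp [mulR1_T₁]
  · intro u
    simp [comulR_tmul]

theorem mulL2_counitTwistR (d p q c : A) : mulL2 c (B.counitTwistR d (p ⊗ₜ[k] q)) =
    B.counitSliceR d (p ⊗ₜ[k] B.T₃ (q ⊗ₜ[k] c)) := by
  rw [counitTwistR_tmul, mulL2_lTensor, counitSliceR_tmul]
  apply lTensor_sliceL_mulR1 B.counit
  · intro s
    simp [← mulL2_T₄]
  · intro u
    simp [comulR_tmul]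

/-- By the axiom on ε and E₁, ε(q₁ s) q₂ c equals q times an element that does not involve q, so q ↦
ε(q₁ s) q₂ is left `A`-linear. -/
theorem counitTwistR_mulL2 (d a : A) (x : A ⊗[k] A) :
    B.counitTwistR d (mulL2 a x) = mulL2 a (B.counitTwistR d x) := by
  induction x with
  | zero => simp
  | add x y hx hy => simp only [map_add, hx, hy]
  | tmul p q =>
    rw [mulL2_tmul, counitTwistR_tmul, counitTwistR_tmul, mulL2_lTensor]
    congr 2
    ext s
    refine B.mulRight_cancel fun c => ?_
    have h1 : ∀ q, sliceL B.counit (B.T₄ (s ⊗ₜ[k] q)) * c =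
        q * sliceL B.counit (B.E₁ (s ⊗ₜ[k] c)) := fun q => by
      rw [← sliceL_mulR2, ← mulR1_T₁, ← B.counit_E₁, sliceL_mulL2]
    simp [h1, mul_assoc]

/-- By coassociativity, x b₁ d₁ ⊗ ε(b₂ d₂) b₃ contains Δ(b₁ d) = Δ(b₁)Δ(d), and the counit law
collapses it to x b₁ d ⊗ b₂. -/
theorem counitTwistR_T₂ (d x b : A) :
    B.counitTwistR d (B.T₂ (x ⊗ₜ[k] b)) = mulR1 d (B.T₂ (x ⊗ₜ[k] b)) := by
  refine B.mulR2_cancel fun c => ?_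
  have h1 : ∀ t : A ⊗[k] A, mulR2 c (B.counitTwistR d t) =
      B.counitSliceR d (on23 B.T₁ (TensorProduct.assoc k A A A (t ⊗ₜ[k] c))) := by
    intro t
    induction t with
    | zero => simp
    | add x y hx hy => simp only [map_add, TensorProduct.add_tmul, hx, hy]
    | tmul p q => simp [mulR2_counitTwistR]
  have h2 : ∀ v : A ⊗[k] A, B.counitSliceR d (on12 B.T₂ (x ⊗ₜ[k] v)) =
      mulL1 x (mulR1 d v) := by
    intro v
    induction v with
    | zero => simp
    | add x y hx hy => simp only [map_add, TensorProduct.tmul_add, hx, hy]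
    | tmul p q => simp [counitSliceR_assoc, ← T₂_mul_apply, sliceR_T₂]
  rw [h1, ← coassoc_apply, h2, mulL1_mulR1, mulL1_T₁, mulR1_mulR2]

/-- The range of E₂ is spanned by the elements (1 ⊗ c)T₂(b ⊗ a), for which the two preceding results
suffice. -/
theorem counitTwistR_E₂ (d : A) (x : A ⊗[k] A) :
    B.counitTwistR d (B.E₂ x) = mulR1 d (B.E₂ x) := by
  induction x with
  | zero => simp
  | add x y hx hy => simp only [map_add, hx, hy]
  | tmul y a =>
    have h : B.E₂ (y ⊗ₜ[k] a) ∈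
        Submodule.span k {x | ∃ a b c : A, x = mulL2 c (B.T₂ (b ⊗ₜ[k] a))} := by
      rw [B.span_E₂]
      exact Submodule.subset_span ⟨y, a, rfl⟩
    generalize B.E₂ (y ⊗ₜ[k] a) = x at h ⊢
    induction h using Submodule.span_induction with
    | mem x h =>
      obtain ⟨a, b, c, rfl⟩ := h
      rw [counitTwistR_mulL2, counitTwistR_T₂, mulL2_mulR1]
    | zero => simp
    | add x y _ _ hx hy => rw [map_add, map_add, hx, hy]
    | smul c x _ hx => rw [map_smul, map_smul, hx]

/-- `(y ⊗ a) E (d ⊗ 1) = y d₁ ⊗ ε(a₁ d₂) a₂`. -/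
theorem mulR1_E₂ (d y a : A) :
    mulR1 d (B.E₂ (y ⊗ₜ[k] a)) = B.counitTwistR d (y ⊗ₜ[k] a) := by
  rw [← counitTwistR_E₂]
  refine B.mulL2_cancel fun c => ?_
  have h1 : ∀ t : A ⊗[k] A, mulL2 c (B.counitTwistR d t) =
      B.counitSliceR d (on23 B.T₃ (TensorProduct.assoc k A A A (t ⊗ₜ[k] c))) := by
    intro t
    induction t with
    | zero => simp
    | add x y hx hy => simp only [map_add, TensorProduct.add_tmul, hx, hy]
    | tmul p q => simp [mulL2_counitTwistR]
  -- The twist does not notice E, because E stands directly in front of Δ(d) and EΔ(d) = Δ(d).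
  have h2 : ∀ v : A ⊗[k] A, B.counitSliceR d (on12 B.E₂ (y ⊗ₜ[k] v)) =
      B.counitSliceR d (y ⊗ₜ[k] v) := by
    intro v
    induction v with
    | zero => simp
    | add x y hx hy => simp only [map_add, TensorProduct.tmul_add, hx, hy]
    | tmul p q =>
      rw [on12_tmul, counitSliceR_assoc, comulR_E₂, ← counitSliceR_assoc,
        TensorProduct.assoc_tmul]
  rw [h1, ← E₂_T₃_coassoc, h2, mulL2_counitTwistR]

/-- Apply A ⊗ ε to the formula for (y ⊗ a)E(d ⊗ 1): the result y d₁ ε(a₁ d₂) ε(a₂) is y d₁ ε(a d₂),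
which is y times the left action on d. -/
theorem piR_mem (a : A) : B.piR a ∈ multiplierAlgebra k A := by
  intro y d
  change y * sliceR B.counit (B.T₃ (d ⊗ₜ[k] a)) = sliceR B.counit (B.E₂ (y ⊗ₜ[k] a)) * d
  rw [← sliceR_mulL1, ← mulL2_T₂, ← sliceR_mulR1, mulR1_E₂, counitTwistR_tmul]
  generalize B.T₂ (y ⊗ₜ[k] d) = t
  induction t with
  | zero => simp
  | add x y hx hy => simp only [map_add, hx, hy]
  | tmul p q => simp [apply_sliceL, sliceR_T₄]

/-! ### `⊓̄ᴿ(a)` is a multiplier -/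

/-- The map `y ⊗ a ↦ d₁ y ⊗ ε(d₂ a₁) a₂`. -/
def counitTwistL (d : A) : A ⊗[k] A →ₗ[k] A ⊗[k] A :=
  LinearMap.lTensor A (sliceL B.counit ∘ₗ B.T₂) ∘ₗ (TensorProduct.assoc k A A A).toLinearMap ∘ₗ
    LinearMap.rTensor A (B.T₄ ∘ₗ (TensorProduct.mk k A A).flip d)

/-- The map `p ⊗ u ⊗ w ↦ d₁ p ε(d₂ u) ⊗ w`. -/
def counitSliceL (d : A) : A ⊗[k] (A ⊗[k] A) →ₗ[k] A ⊗[k] A :=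
  LinearMap.rTensor A (sliceR B.counit ∘ₗ B.comulL d) ∘ₗ
    (TensorProduct.assoc k A A A).symm.toLinearMap

theorem counitTwistL_tmul (d p q : A) : B.counitTwistL d (p ⊗ₜ[k] q) =
    LinearMap.lTensor A (sliceL B.counit ∘ₗ B.T₂ ∘ₗ (TensorProduct.mk k A A).flip q)
      (B.T₄ (p ⊗ₜ[k] d)) := by
  simp only [counitTwistL, LinearMap.comp_apply, LinearMap.rTensor_tmul, LinearMap.flip_apply,
    TensorProduct.mk_apply, LinearEquiv.coe_coe, lTensor_comp_assoc_tmul, LinearMap.comp_assoc]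

theorem counitSliceL_tmul (d p : A) (v : A ⊗[k] A) : B.counitSliceL d (p ⊗ₜ[k] v) =
    LinearMap.rTensor A (sliceR B.counit ∘ₗ B.comulL d ∘ₗ TensorProduct.mk k A A p) v := by
  simp only [counitSliceL, LinearMap.comp_apply, LinearEquiv.coe_coe,
    rTensor_comp_assoc_symm_tmul, LinearMap.comp_assoc]

theorem counitSliceL_assoc (d w : A) (x : A ⊗[k] A) :
    B.counitSliceL d (TensorProduct.assoc k A A A (x ⊗ₜ[k] w)) =
      sliceR B.counit (B.comulL d x) ⊗ₜ[k] w := by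
  simp [counitSliceL]

theorem mulL2_counitTwistL (d p q c : A) : mulL2 c (B.counitTwistL d (p ⊗ₜ[k] q)) =
    B.counitSliceL d (p ⊗ₜ[k] B.T₃ (q ⊗ₜ[k] c)) := by
  rw [counitTwistL_tmul, mulL2_lTensor, counitSliceL_tmul]
  apply lTensor_sliceL_mulL1 B.counit
  · intro s
    simp [← mulL2_T₂]
  · intro u
    simp [comulL_tmul]

theorem mulR2_counitTwistL (d p q c : A) : mulR2 c (B.counitTwistL d (p ⊗ₜ[k] q)) =
    B.counitSliceL d (p ⊗ₜ[k] B.T₁ (q ⊗ₜ[k] c)) := by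
  rw [counitTwistL_tmul, mulR2_lTensor, counitSliceL_tmul]
  apply lTensor_sliceL_mulL1 B.counit
  · intro s
    simp [mulL1_T₁]
  · intro u
    simp [comulL_tmul]

/-- Mirror image of `counitTwistR_mulL2`: the axiom on ε and E₂ makes q ↦ ε(s q₁) q₂ right
`A`-linear. -/
theorem counitTwistL_mulR2 (d a : A) (x : A ⊗[k] A) :
    B.counitTwistL d (mulR2 a x) = mulR2 a (B.counitTwistL d x) := by
  induction x with
  | zero => simp
  | add x y hx hy => simp only [map_add, hx, hy]
  | tmul p q =>
    rw [mulR2_tmul, counitTwistL_tmul, counitTwistL_tmul, mulR2_lTensor]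
    congr 2
    ext s
    refine B.mulLeft_cancel fun c => ?_
    have h1 : ∀ q, c * sliceL B.counit (B.T₂ (s ⊗ₜ[k] q)) =
        sliceL B.counit (B.E₂ (s ⊗ₜ[k] c)) * q := fun q => by
      rw [← sliceL_mulL2, ← B.counit_E₂, sliceL_mulR2]
    simp [h1, ← mul_assoc]

theorem counitTwistL_T₄ (d x b : A) :
    B.counitTwistL d (B.T₄ (x ⊗ₜ[k] b)) = mulL1 d (B.T₄ (x ⊗ₜ[k] b)) := by
  refine B.mulL2_cancel fun c => ?_
  have h1 : ∀ t : A ⊗[k] A, mulL2 c (B.counitTwistL d t) =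
      B.counitSliceL d (on23 B.T₃ (TensorProduct.assoc k A A A (t ⊗ₜ[k] c))) := by
    intro t
    induction t with
    | zero => simp
    | add x y hx hy => simp only [map_add, TensorProduct.add_tmul, hx, hy]
    | tmul p q => simp [mulL2_counitTwistL]
  have h2 : ∀ v : A ⊗[k] A, B.counitSliceL d (on12 B.T₄ (x ⊗ₜ[k] v)) =
      mulR1 x (mulL1 d v) := by
    intro v
    induction v with
    | zero => simp
    | add x y hx hy => simp only [map_add, TensorProduct.tmul_add, hx, hy]
    | tmul p q => simp [counitSliceL_assoc, ← T₄_mul_apply, sliceR_T₄]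
  rw [h1, ← coassoc_T₄_T₃, h2, ← mulL1_mulR1, ← mulL2_T₄, mulL1_mulL2]

theorem counitTwistL_E₁ (d : A) (x : A ⊗[k] A) :
    B.counitTwistL d (B.E₁ x) = mulL1 d (B.E₁ x) := by
  induction x with
  | zero => simp
  | add x y hx hy => simp only [map_add, hx, hy]
  | tmul y a =>
    have h : B.E₁ (y ⊗ₜ[k] a) ∈
        Submodule.span k {x | ∃ a b c : A, x = mulR1 b (B.T₁ (a ⊗ₜ[k] c))} := by
      rw [B.span_E₁]
      exact Submodule.subset_span ⟨y, a, rfl⟩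
    generalize B.E₁ (y ⊗ₜ[k] a) = x at h ⊢
    induction h using Submodule.span_induction with
    | mem x h =>
      obtain ⟨a, b, c, rfl⟩ := h
      rw [mulR1_T₁, counitTwistL_mulR2, counitTwistL_T₄, mulL1_mulR2]
    | zero => simp
    | add x y _ _ hx hy => rw [map_add, map_add, hx, hy]
    | smul c x _ hx => rw [map_smul, map_smul, hx]

/-- `(d ⊗ 1) E (y ⊗ a) = d₁ y ⊗ ε(d₂ a₁) a₂`. -/
theorem mulL1_E₁ (d y a : A) :
    mulL1 d (B.E₁ (y ⊗ₜ[k] a)) = B.counitTwistL d (y ⊗ₜ[k] a) := by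
  rw [← counitTwistL_E₁]
  refine B.mulR2_cancel fun c => ?_
  have h1 : ∀ t : A ⊗[k] A, mulR2 c (B.counitTwistL d t) =
      B.counitSliceL d (on23 B.T₁ (TensorProduct.assoc k A A A (t ⊗ₜ[k] c))) := by
    intro t
    induction t with
    | zero => simp
    | add x y hx hy => simp only [map_add, TensorProduct.add_tmul, hx, hy]
    | tmul p q => simp [mulR2_counitTwistL]
  have h2 : ∀ v : A ⊗[k] A, B.counitSliceL d (on12 B.E₁ (y ⊗ₜ[k] v)) =
      B.counitSliceL d (y ⊗ₜ[k] v) := by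
    intro v
    induction v with
    | zero => simp
    | add x y hx hy => simp only [map_add, TensorProduct.tmul_add, hx, hy]
    | tmul p q =>
      rw [on12_tmul, counitSliceL_assoc, comulL_E₁, ← counitSliceL_assoc,
        TensorProduct.assoc_tmul]
  rw [h1, ← E₁_T₁_coassoc, h2, mulR2_counitTwistL]

theorem piBarR_mem (a : A) : B.piBarR a ∈ multiplierAlgebra k A := by
  intro d y
  change d * sliceR B.counit (B.E₁ (y ⊗ₜ[k] a)) = sliceR B.counit (B.T₁ (d ⊗ₜ[k] a)) * y
  rw [← sliceR_mulL1, ← sliceR_mulR1, mulR1_T₁, mulL1_E₁, counitTwistL_tmul]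
  generalize B.T₄ (y ⊗ₜ[k] d) = t
  induction t with
  | zero => simp
  | add x y hx hy => simp only [map_add, hx, hy]
  | tmul p q => simp [apply_sliceL, sliceR_T₂]

/-! ### Multipliers -/

theorem multiplier_ext (B : RegularWMB k A) {p q : MulPair k A} (hp : p ∈ multiplierAlgebra k A)
    (hq : q ∈ multiplierAlgebra k A) (h : ∀ a, actOn a p = actOn a q) : p = q := by
  have h2 : ∀ a, onAct a p = onAct a q := fun a =>
    B.mulRight_cancel fun b => (hp a b).symm.trans ((congrArg (a * ·) (h b)).trans (hq a b))
  exact Prod.ext (LinearMap.ext h) (MulOpposite.unop_injective (LinearMap.ext h2))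

theorem onAct_mul_left (B : RegularWMB k A) {p : MulPair k A} (hp : p ∈ multiplierAlgebra k A)
    (a b : A) : onAct (a * b) p = a * onAct b p :=
  B.mulRight_cancel fun c => by rw [← hp (a * b) c, mul_assoc, mul_assoc, ← hp b c]

theorem actOn_mul_right (B : RegularWMB k A) {p : MulPair k A} (hp : p ∈ multiplierAlgebra k A)
    (a b : A) : actOn (a * b) p = actOn a p * b :=
  B.mulLeft_cancel fun c => by rw [hp c (a * b), ← mul_assoc, ← mul_assoc, hp c a]

theorem actOn_mul (a : A) (p q : MulPair k A) : actOn a (p * q) = actOn (actOn a q) p := rfl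

theorem onAct_mul (a : A) (p q : MulPair k A) : onAct a (p * q) = onAct (onAct a p) q := rfl

variable (B : RegularWMB k A)

theorem actOn_piR (a d : A) : actOn d (B.piR a) = sliceR B.counit (B.T₃ (d ⊗ₜ[k] a)) := rfl
theorem onAct_piR (a d : A) : onAct d (B.piR a) = sliceR B.counit (B.E₂ (d ⊗ₜ[k] a)) := rfl
theorem onAct_piBarR (a d : A) : onAct d (B.piBarR a) = sliceR B.counit (B.T₁ (d ⊗ₜ[k] a)) := rfl

theorem mul_actOn_piR (a d x : A) :
    x * actOn d (B.piR a) = sliceR B.counit (mulL2 a (B.T₂ (x ⊗ₜ[k] d))) := by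
  rw [actOn_piR, ← sliceR_mulL1, mulL2_T₂]

theorem actOn_piR_mul (a d x : A) :
    actOn d (B.piR a) * x = sliceR B.counit (mulL2 a (B.T₄ (x ⊗ₜ[k] d))) := by
  rw [actOn_piR, ← sliceR_mulR1, mulL2_T₄]

theorem mul_onAct_piBarR (a d x : A) :
    x * onAct d (B.piBarR a) = sliceR B.counit (mulR2 a (B.T₂ (x ⊗ₜ[k] d))) := by
  rw [onAct_piBarR, ← sliceR_mulL1, mulL1_T₁]

theorem counit_actOn_piR (a d : A) : B.counit (actOn d (B.piR a)) = B.counit (a * d) := by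
  rw [actOn_piR, ← apply_sliceL, sliceL_T₃]

theorem counit_onAct_piBarR (a d : A) : B.counit (onAct d (B.piBarR a)) = B.counit (d * a) := by
  rw [onAct_piBarR, ← apply_sliceL, sliceL_T₁]

/-- `⊓ᴿ(a)` only depends on the functional `ε(a -)`. -/
theorem piR_congr {a b : A} (h : ∀ d, B.counit (a * d) = B.counit (b * d)) :
    B.piR a = B.piR b := by
  refine B.multiplier_ext (B.piR_mem a) (B.piR_mem b) fun d => B.mulLeft_cancel fun x => ?_
  rw [mul_actOn_piR, mul_actOn_piR]
  induction B.T₂ (x ⊗ₜ[k] d) with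
  | zero => simp
  | add x y hx hy => simp only [map_add, hx, hy]
  | tmul p q => simp [h]

/-! ### The ranges of `⊓ᴿ` and `⊓̄ᴿ` -/

theorem lTensor_sliceR_on12 (f : A ⊗[k] A →ₗ[k] A ⊗[k] A) (ω : A →ₗ[k] k) (a : A)
    (t : A ⊗[k] A) : LinearMap.lTensor A (sliceR ω) (on12 f (a ⊗ₜ[k] t)) =
      f (a ⊗ₜ[k] sliceR ω t) := by
  induction t with
  | zero => simp
  | add x y hx hy => simp only [map_add, TensorProduct.tmul_add, hx, hy]
  | tmul b c =>
    rw [on12_tmul, sliceR_tmul, TensorProduct.tmul_smul, map_smul]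
    induction f (a ⊗ₜ[k] b) with
    | zero => simp
    | add x y hx hy => simp only [map_add, TensorProduct.add_tmul, smul_add, hx, hy]
    | tmul => simp

theorem lTensor_sliceL_on12 (f : A ⊗[k] A →ₗ[k] A ⊗[k] A) (ω : A →ₗ[k] k) (a : A)
    (t : A ⊗[k] A) : LinearMap.lTensor A (sliceL ω) (on12 f (a ⊗ₜ[k] t)) =
      LinearMap.rTensor A (sliceR ω ∘ₗ f ∘ₗ TensorProduct.mk k A A a) t := by
  induction t with
  | zero => simp
  | add x y hx hy => simp only [map_add, TensorProduct.tmul_add, hx, hy]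
  | tmul b c =>
    simp only [on12_tmul, LinearMap.rTensor_tmul, LinearMap.comp_apply, TensorProduct.mk_apply]
    induction f (a ⊗ₜ[k] b) with
    | zero => simp
    | add x y hx hy => simp only [map_add, TensorProduct.add_tmul, hx, hy]
    | tmul => simp [TensorProduct.smul_tmul]

/-- `⊓̄ᴿ(b₁) ⊗ b₂ c = E (1 ⊗ b c)`. -/
theorem rTensor_piBarR_T₁ (a b c : A) :
    LinearMap.rTensor A (actOn a ∘ₗ B.piBarR) (B.T₁ (b ⊗ₜ[k] c)) = B.E₁ (a ⊗ₜ[k] (b * c)) := by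
  -- Applying ε to the middle leg turns E₁ into ⊓̄ᴿ on one side and removes T₁ on the other.
  have h := congrArg (LinearMap.lTensor A (sliceL B.counit)) (B.E₁_T₁_coassoc a b c)
  have h1 : ∀ s : A ⊗[k] A, LinearMap.lTensor A (sliceL B.counit)
      (on23 B.T₁ (TensorProduct.assoc k A A A (s ⊗ₜ[k] c))) = mulR2 c s := by
    intro s
    induction s with
    | zero => simp
    | add x y hx hy => simp only [map_add, TensorProduct.add_tmul, hx, hy]
    | tmul => simp [sliceL_T₁]
  rw [lTensor_sliceL_on12, h1, ← E₁_mulR2, mulR2_tmul] at h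
  exact h

/-- `⊓ᴿ(b₁) ⊗ c b₂ = (1 ⊗ c b) E`. -/
theorem rTensor_piR_T₃ (a b c : A) :
    LinearMap.rTensor A (onAct a ∘ₗ B.piR) (B.T₃ (b ⊗ₜ[k] c)) = B.E₂ (a ⊗ₜ[k] (c * b)) := by
  have h := congrArg (LinearMap.lTensor A (sliceL B.counit)) (B.E₂_T₃_coassoc a b c)
  have h1 : ∀ s : A ⊗[k] A, LinearMap.lTensor A (sliceL B.counit)
      (on23 B.T₃ (TensorProduct.assoc k A A A (s ⊗ₜ[k] c))) = mulL2 c s := by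
    intro s
    induction s with
    | zero => simp
    | add x y hx hy => simp only [map_add, TensorProduct.add_tmul, hx, hy]
    | tmul => simp [sliceL_T₃]
  rw [lTensor_sliceL_on12, h1, ← E₂_mulL2, mulL2_tmul] at h
  exact h

/-- `⊓ᴿ` as a map to the multiplier algebra. -/
def piRMul : A →ₗ[k] Subalgebra.toSubmodule (multiplierAlgebra k A) :=
  B.piR.codRestrict _ B.piR_mem

/-- `⊓̄ᴿ` as a map to the multiplier algebra. -/
def piBarRMul : A →ₗ[k] Subalgebra.toSubmodule (multiplierAlgebra k A) :=
  B.piBarR.codRestrict _ B.piBarR_mem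

/-- Two expansions of (1 ⊗ xy)E(1 ⊗ bc), one through E₁ and one through E₂. This is the link between
the two ranges. -/
theorem lTensor_rTensor_piBarRMul (x y b c : A) :
    LinearMap.lTensor _ (LinearMap.mulLeft k (x * y))
      (LinearMap.rTensor A B.piBarRMul (B.T₁ (b ⊗ₜ[k] c))) =
    LinearMap.lTensor _ (LinearMap.mulRight k (b * c))
      (LinearMap.rTensor A B.piRMul (B.T₃ (y ⊗ₜ[k] x))) := by
  refine rTensor_jointly_injective
    (fun a : A => actOn a ∘ₗ (Subalgebra.toSubmodule (multiplierAlgebra k A)).subtype)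
    (fun p hp => Subtype.ext (B.multiplier_ext p.2 (zero_mem (multiplierAlgebra k A)) fun a => ?_))
    fun a => B.mulL1_cancel fun d => ?_
  · simpa using hp a
  have h1 : ∀ (f : A →ₗ[k] A) (g : A →ₗ[k] Subalgebra.toSubmodule (multiplierAlgebra k A))
      (t : A ⊗[k] A), LinearMap.rTensor A
        (actOn a ∘ₗ (Subalgebra.toSubmodule (multiplierAlgebra k A)).subtype)
        (LinearMap.lTensor _ f (LinearMap.rTensor A g t)) = LinearMap.lTensor A f
      (LinearMap.rTensor A
        (actOn a ∘ₗ (Subalgebra.toSubmodule (multiplierAlgebra k A)).subtype ∘ₗ g) t) := by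
    intro f g t
    induction t with
    | zero => simp
    | add x y hx hy => simp only [map_add, hx, hy]
    | tmul => simp
  have h2 : ∀ t : A ⊗[k] A, mulL1 d (LinearMap.rTensor A (actOn a ∘ₗ B.piR) t) =
      mulR1 a (LinearMap.rTensor A (onAct d ∘ₗ B.piR) t) := by
    intro t
    induction t with
    | zero => simp
    | add x y hx hy => simp only [map_add, hx, hy]
    | tmul p q =>
      simp only [LinearMap.rTensor_tmul, mulL1_tmul, mulR1_tmul, LinearMap.comp_apply]
      rw [B.piR_mem p d a]
  rw [h1, h1]
  change mulL1 d (mulL2 (x * y) (LinearMap.rTensor A (actOn a ∘ₗ B.piBarR) (B.T₁ (b ⊗ₜ[k] c)))) =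
    mulL1 d (mulR2 (b * c) (LinearMap.rTensor A (actOn a ∘ₗ B.piR) (B.T₃ (y ⊗ₜ[k] x))))
  rw [rTensor_piBarR_T₁, ← tmul_mul_eq, mul_E₁, mul_tmul_eq, mulL1_mulR2, h2, rTensor_piR_T₃,
    mulR1_mulR2]

theorem mul_sliceL_piBarRMul
    (φ : Subalgebra.toSubmodule (multiplierAlgebra k A) →ₗ[k] k) (x y b c : A) :
    (x * y) * sliceL (φ ∘ₗ B.piBarRMul) (B.T₁ (b ⊗ₜ[k] c)) =
      sliceL (φ ∘ₗ B.piRMul) (B.T₃ (y ⊗ₜ[k] x)) * (b * c) := by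
  have h := congrArg (fun t => TensorProduct.lid k A (LinearMap.rTensor A φ t))
    (B.lTensor_rTensor_piBarRMul x y b c)
  have h1 : ∀ (f : A →ₗ[k] A) (g : A →ₗ[k] Subalgebra.toSubmodule (multiplierAlgebra k A))
      (t : A ⊗[k] A), TensorProduct.lid k A (LinearMap.rTensor A φ
        (LinearMap.lTensor _ f (LinearMap.rTensor A g t))) = f (sliceL (φ ∘ₗ g) t) := by
    intro f g t
    induction t with
    | zero => simp
    | add x y hx hy => simp only [map_add, hx, hy]
    | tmul => simp
  simp only [h1] at h
  exact h

variable {B}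

/-- Applying a further functional ω to the slice shows that φ kills every (A ⊗ ω)T₁(b ⊗ c), and
these span `A`. -/
theorem IsRightFull.eq_zero (hB : B.IsRightFull) (φ : A →ₗ[k] k)
    (h : ∀ b c, sliceL φ (B.T₁ (b ⊗ₜ[k] c)) = 0) : φ = 0 := by
  have h1 : (⊤ : Submodule k A) ≤ LinearMap.ker φ := by
    rw [← hB, Submodule.span_le]
    rintro _ ⟨a, b, ω, rfl⟩
    simp [← apply_sliceL, h]
  exact LinearMap.ext fun x => h1 (Submodule.mem_top (x := x))

/-- If φ kills one range, one side of `mul_sliceL_piBarRMul` vanishes. Idempotency and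
non-degeneracy then kill the slice on the other side, and right fullness kills the functional. -/
theorem IsRightFull.comp_piRMul_eq_zero_iff (hB : B.IsRightFull)
    (φ : Subalgebra.toSubmodule (multiplierAlgebra k A) →ₗ[k] k) :
    φ ∘ₗ B.piRMul = 0 ↔ φ ∘ₗ B.piBarRMul = 0 := by
  constructor
  · intro h
    refine hB.eq_zero _ fun b c => B.nondeg_right _ fun z => ?_
    refine B.induction_on_mul (p := fun z => z * _ = 0) z (zero_mul _) ?_ ?_
    · intro x y hx hy
      rw [add_mul, hx, hy, add_zero]
    · intro x y
      rw [mul_sliceL_piBarRMul, h]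
      simp [sliceL]
  · intro h
    refine hB.eq_zero _ fun b c => B.nondeg_right _ fun x => ?_
    rw [← sliceL_mulL2, B.T₁_T₃, sliceL_mulR2]
    have h1 : sliceL (φ ∘ₗ B.piRMul) (B.T₃ (b ⊗ₜ[k] x)) = 0 := by
      refine B.nondeg_left _ fun z => ?_
      refine B.induction_on_mul (p := fun z => _ * z = 0) z (mul_zero _) ?_ ?_
      · intro x y hx hy
        rw [mul_add, hx, hy, add_zero]
      · intro y z
        rw [← mul_sliceL_piBarRMul, h]
        simp [sliceL]
    rw [h1, zero_mul]

theorem le_of_forall_dual {V : Type*} [AddCommGroup V] [Module k V] {S T : Submodule k V}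
    (h : ∀ φ : V →ₗ[k] k, T ≤ LinearMap.ker φ → S ≤ LinearMap.ker φ) : S ≤ T := by
  intro x hx
  by_contra hxT
  obtain ⟨φ, hφ, hT⟩ := Submodule.exists_le_ker_of_notMem hxT
  exact hφ (h φ hT hx)

theorem IsRightFull.range_piRMul (hB : B.IsRightFull) :
    LinearMap.range B.piRMul = LinearMap.range B.piBarRMul := by
  apply le_antisymm
  · refine le_of_forall_dual fun φ h => ?_
    rw [LinearMap.range_le_ker_iff] at h ⊢
    exact (hB.comp_piRMul_eq_zero_iff φ).2 h
  · refine le_of_forall_dual fun φ h => ?_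
    rw [LinearMap.range_le_ker_iff] at h ⊢
    exact (hB.comp_piRMul_eq_zero_iff φ).1 h

theorem IsRightFull.range_piR (hB : B.IsRightFull) :
    LinearMap.range B.piR = LinearMap.range B.piBarR := by
  have h := congrArg (Submodule.map (Submodule.subtype _)) hB.range_piRMul
  rwa [← LinearMap.range_comp, ← LinearMap.range_comp] at h

variable (B)

/-! ### The base algebra -/

/-- `Δ(r d) = (1 ⊗ r) Δ(d)` for `r = ⊓ᴿ(b)`. -/
theorem T₂_actOn_piR (x b d : A) : B.T₂ (x ⊗ₜ[k] actOn d (B.piR b)) =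
    LinearMap.lTensor A (B.piR b).1 (B.T₂ (x ⊗ₜ[k] d)) := by
  -- Here ε is applied to the last leg, so that T₃ becomes the left action of ⊓ᴿ(b).
  have h := congrArg (LinearMap.lTensor A (sliceR B.counit)) (B.coassoc_T₂_T₃ x d b)
  rw [lTensor_sliceR_on12, ← actOn_piR] at h
  rw [h]
  exact (LinearMap.comp_apply _ _ _).symm.trans (LinearMap.congr_fun
    (LinearMap.lTensor_comp A (sliceR B.counit) B.T₃).symm _) |>.trans
    (lTensor_comp_assoc_tmul _ _ _)

/-- `Δ(d r) = Δ(d) (1 ⊗ r)` for `r = ⊓̄ᴿ(b)`. -/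
theorem T₂_onAct_piBarR (x b d : A) : B.T₂ (x ⊗ₜ[k] onAct d (B.piBarR b)) =
    LinearMap.lTensor A (B.piBarR b).2.unop (B.T₂ (x ⊗ₜ[k] d)) := by
  have h := congrArg (LinearMap.lTensor A (sliceR B.counit)) (B.coassoc_apply x d b)
  rw [lTensor_sliceR_on12, ← onAct_piBarR] at h
  rw [h]
  exact (LinearMap.comp_apply _ _ _).symm.trans (LinearMap.congr_fun
    (LinearMap.lTensor_comp A (sliceR B.counit) B.T₁).symm _) |>.trans
    (lTensor_comp_assoc_tmul _ _ _)

/-- With r = ⊓ᴿ(b), Δ(r d) = (1 ⊗ r)Δ(d) reduces the claim to ε(a (r q)) = ε((a r) q). It makes the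
range a subalgebra and ⊓ᴿ right linear over it. -/
theorem piR_mul_piR (a b : A) : B.piR a * B.piR b = B.piR (onAct a (B.piR b)) := by
  refine B.multiplier_ext (mul_mem (B.piR_mem a) (B.piR_mem b)) (B.piR_mem _)
    fun d => B.mulLeft_cancel fun x => ?_
  rw [actOn_mul, mul_actOn_piR, T₂_actOn_piR, mul_actOn_piR]
  congr 1
  induction B.T₂ (x ⊗ₜ[k] d) with
  | zero => simp
  | add x y hx hy => simp only [map_add, hx, hy]
  | tmul p q =>
    rw [LinearMap.lTensor_tmul, mulL2_tmul, mulL2_tmul]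
    exact congrArg _ (B.piR_mem b a q)

/-- The base algebra of a regular weak multiplier bialgebra: the range of `⊓ᴿ`. -/
def baseAlgebra : NonUnitalSubalgebra k (MulPair k A) where
  __ := LinearMap.range B.piR
  mul_mem' := by
    rintro _ _ ⟨a, rfl⟩ ⟨b, rfl⟩
    exact ⟨_, (B.piR_mul_piR a b).symm⟩

theorem mem_baseAlgebra {p : MulPair k A} : p ∈ B.baseAlgebra ↔ ∃ a, B.piR a = p := Iff.rfl

theorem IsRightFull.mem_baseAlgebra {B : RegularWMB k A} (hB : B.IsRightFull)
    {p : MulPair k A} : p ∈ B.baseAlgebra ↔ ∃ a, B.piBarR a = p :=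
  SetLike.ext_iff.1 hB.range_piR p

theorem baseAlgebra_le {p : MulPair k A} (hp : p ∈ B.baseAlgebra) :
    p ∈ multiplierAlgebra k A := by
  obtain ⟨a, rfl⟩ := hp
  exact B.piR_mem a

theorem IsRightFull.isBaseAlgebra {B : RegularWMB k A} (hB : B.IsRightFull) :
    B.IsBaseAlgebra B.baseAlgebra :=
  ⟨fun _ => B.baseAlgebra_le, rfl, hB.range_piR⟩

theorem piR_mul {r : MulPair k A} (hr : r ∈ B.baseAlgebra) (a : A) :
    B.piR a * r = B.piR (onAct a r) := by
  obtain ⟨b, rfl⟩ := hr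
  exact B.piR_mul_piR a b

/-- `⊓ᴿ` as a map to the base algebra. -/
def piRBase : A →ₗ[k] B.baseAlgebra := B.piR.codRestrict B.baseAlgebra.toSubmodule fun a => ⟨a, rfl⟩

@[simp] theorem coe_piRBase (a : A) : (B.piRBase a : MulPair k A) = B.piR a := rfl

theorem piRBase_surjective : Function.Surjective B.piRBase := by
  rintro ⟨_, a, rfl⟩
  exact ⟨a, rfl⟩

/-! ### The counit of the base algebra -/

/-- The right action of the base algebra on `A`. -/
def baseAct : A ⊗[k] B.baseAlgebra →ₗ[k] A :=
  TensorProduct.lift ((MulOpposite.opLinearEquiv k).symm.toLinearMap ∘ₗ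
    LinearMap.snd k (Module.End k A) (Module.End k A)ᵐᵒᵖ ∘ₗ
    B.baseAlgebra.toSubmodule.subtype).flip

@[simp] theorem baseAct_tmul (a : A) (r : B.baseAlgebra) :
    B.baseAct (a ⊗ₜ[k] r) = onAct a (r : MulPair k A) := rfl

/-- `a₁ ⊓ᴿ(a₂) = a`. -/
theorem baseAct_T₂ (X : A ⊗[k] A) :
    B.baseAct (LinearMap.lTensor A B.piRBase (B.T₂ X)) = LinearMap.mul' k A X := by
  have h1 : ∀ t : A ⊗[k] A, B.baseAct (LinearMap.lTensor A B.piRBase t) =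
      sliceR B.counit (B.E₂ t) := by
    intro t
    induction t with
    | zero => simp
    | add x y hx hy => simp only [map_add, hx, hy]
    | tmul p q => simp only [LinearMap.lTensor_tmul, baseAct_tmul, coe_piRBase, onAct_piR]
  rw [h1]
  induction X with
  | zero => simp
  | add x y hx hy => simp only [map_add, hx, hy]
  | tmul p q => rw [E₂_T₂_apply, sliceR_T₂, LinearMap.mul'_apply]

/-- For a product x this reads x₁ ε(x₂ d) = x ⊓̄ᴿ(d), the rule that converts slices of T₂ into
actions of the base algebra. -/
theorem sliceR_mulR2_T₂ (X : A ⊗[k] A) (d : A) :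
    sliceR B.counit (mulR2 d (B.T₂ X)) = onAct (LinearMap.mul' k A X) (B.piBarR d) := by
  induction X with
  | zero => simp
  | add x y hx hy => simp only [map_add, hx, hy, onAct_apply]
  | tmul a b =>
    rw [← mul_onAct_piBarR, LinearMap.mul'_apply, B.onAct_mul_left (B.piBarR_mem d)]

/-- Every element of `A` has a right unit in the base algebra. -/
theorem IsRightFull.exists_onAct_eq {B : RegularWMB k A} (hB : B.IsRightFull) (x : A) :
    ∃ r ∈ B.baseAlgebra, onAct x r = x := by
  obtain ⟨X, rfl⟩ := B.idempotent x
  set x := LinearMap.mul' k A X with hx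
  let act : B.baseAlgebra →ₗ[k] A := B.baseAct ∘ₗ TensorProduct.mk k A B.baseAlgebra x
  let S : Submodule k A := LinearMap.range act
  have hS : ∀ r ∈ B.baseAlgebra, onAct x r ∈ S := fun r hr => ⟨⟨r, hr⟩, rfl⟩
  -- With S = xR, the tensor x₁ ⊗ ⊓ᴿ(x₂) is shown to lie in S ⊗ R by showing that it vanishes in
  -- (A/S) ⊗ R.
  have h0 : LinearMap.rTensor B.baseAlgebra S.mkQ
      (LinearMap.lTensor A B.piRBase (B.T₂ X)) = 0 := by
    refine eq_zero_of_forall_rTensor_dual _ fun χ => ?_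
    apply (TensorProduct.lid k B.baseAlgebra).injective
    have h1 : ∀ t : A ⊗[k] A, TensorProduct.lid k B.baseAlgebra (LinearMap.rTensor B.baseAlgebra χ
        (LinearMap.rTensor B.baseAlgebra S.mkQ (LinearMap.lTensor A B.piRBase t))) =
        B.piRBase (sliceL (χ ∘ₗ S.mkQ) t) := by
      intro t
      induction t with
      | zero => simp
      | add x y hx hy => simp only [map_add, hx, hy]
      | tmul p q => simp
    rw [h1, map_zero]
    apply Subtype.ext
    rw [coe_piRBase, ZeroMemClass.coe_zero, ← map_zero B.piR]
    -- For a functional χ on A/S, χ(x₁) ε(x₂ d) = χ(x ⊓̄ᴿ(d)), which is zero since x ⊓̄ᴿ(d) ∈ xR by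
    -- equality of the ranges.
    refine B.piR_congr fun d => ?_
    rw [← sliceL_mulR2, apply_sliceL, sliceR_mulR2_T₂, zero_mul, map_zero, ← hx,
      LinearMap.comp_apply, Submodule.mkQ_apply, (Submodule.Quotient.mk_eq_zero S).2, map_zero]
    exact hS _ (hB.mem_baseAlgebra.2 ⟨d, rfl⟩)
  have hex := rTensor_exact B.baseAlgebra (f := S.subtype) (g := S.mkQ)
    (LinearMap.exact_subtype_mkQ S) S.mkQ_surjective
  obtain ⟨T, hT⟩ := (hex _).1 h0
  have h2 : ∀ T : S ⊗[k] B.baseAlgebra,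
      B.baseAct (LinearMap.rTensor B.baseAlgebra S.subtype T) ∈ S := by
    intro T
    induction T with
    | zero => simp
    | add x y hx hy => rw [map_add, map_add]; exact add_mem hx hy
    | tmul s r =>
      obtain ⟨_, r', rfl⟩ := s
      exact hS _ (mul_mem r'.2 r.2)
  -- Acting with the second leg on the first gives x = x₁ ⊓ᴿ(x₂) ∈ SR ⊆ S.
  obtain ⟨r, hr⟩ : x ∈ S := by
    rw [hx, ← baseAct_T₂, ← hT]
    exact h2 T
  exact ⟨r, r.2, hr⟩

/-- Choose c with a = a ⊓̄ᴿ(c); then ε(a) = ε(a c) = ε(⊓ᴿ(a) c) = 0. This is the well-definedness of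
the counit of R. -/
theorem IsRightFull.counit_eq_zero {B : RegularWMB k A} (hB : B.IsRightFull) {a : A}
    (ha : B.piR a = 0) : B.counit a = 0 := by
  obtain ⟨r, hr, h⟩ := hB.exists_onAct_eq a
  obtain ⟨c, rfl⟩ := hB.mem_baseAlgebra.1 hr
  rw [← h, counit_onAct_piBarR, ← counit_actOn_piR, ha]
  simp

/-! ### The multiplier `F` -/

/-- The map `a ⊗ b ⊗ c ↦ ⊓̄ᴿ(b₂) a ⊗ b₁ c`. -/
def preBaseMulL : A ⊗[k] (A ⊗[k] A) →ₗ[k] A ⊗[k] A :=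
  LinearMap.rTensor A (sliceR B.counit ∘ₗ B.E₁) ∘ₗ (TensorProduct.assoc k A A A).symm.toLinearMap ∘ₗ
    LinearMap.lTensor A ((TensorProduct.comm k A A).toLinearMap ∘ₗ B.T₄ ∘ₗ
      (TensorProduct.comm k A A).toLinearMap)

/-- The map `a ⊗ b ⊗ c ↦ a b₁ ⊗ c ⊓ᴿ(b₂)`. -/
def preBaseMulR : (A ⊗[k] A) ⊗[k] A →ₗ[k] A ⊗[k] A :=
  LinearMap.lTensor A (sliceR B.counit ∘ₗ B.E₂ ∘ₗ (TensorProduct.comm k A A).toLinearMap) ∘ₗ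
    (TensorProduct.assoc k A A A).toLinearMap ∘ₗ LinearMap.rTensor A B.T₂

theorem preBaseMulL_tmul (a b c : A) : B.preBaseMulL (a ⊗ₜ[k] (b ⊗ₜ[k] c)) =
    LinearMap.rTensor A (actOn a ∘ₗ B.piBarR)
      (TensorProduct.comm k A A (B.T₄ (c ⊗ₜ[k] b))) := by
  simp only [preBaseMulL, LinearMap.comp_apply, LinearMap.lTensor_tmul, LinearEquiv.coe_coe,
    TensorProduct.comm_tmul, rTensor_comp_assoc_symm_tmul]
  rfl

theorem preBaseMulR_tmul (a b c : A) : B.preBaseMulR ((a ⊗ₜ[k] b) ⊗ₜ[k] c) =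
    LinearMap.lTensor A (onAct c ∘ₗ B.piR) (B.T₂ (a ⊗ₜ[k] b)) := by
  simp only [preBaseMulR, LinearMap.comp_apply, LinearMap.rTensor_tmul, LinearEquiv.coe_coe,
    lTensor_comp_assoc_tmul]
  rfl

/-- On x = (a ⊗ b) ⊗ c and y = a' ⊗ (b' ⊗ c') both sides equal a b₁ a' ⊗ c b'₁ c' scaled by ε(b₂
b'₂). -/
theorem preBaseMul_compat (x : (A ⊗[k] A) ⊗[k] A) (y : A ⊗[k] (A ⊗[k] A)) :
    LinearMap.rTensor A (LinearMap.mul' k A) x * B.preBaseMulL y =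
      B.preBaseMulR x * LinearMap.lTensor A (LinearMap.mul' k A) y := by
  induction x with
  | zero => simp
  | add x x' hx hx' => simp only [map_add, add_mul, hx, hx']
  | tmul ab c =>
    induction ab with
    | zero => simp
    | add x x' hx hx' => simp only [map_add, TensorProduct.add_tmul, add_mul, hx, hx']
    | tmul a b =>
      induction y with
      | zero => simp
      | add y y' hy hy' => simp only [map_add, mul_add, hy, hy']
      | tmul a' bc =>
        induction bc with
        | zero => simp
        | add y y' hy hy' => simp only [map_add, TensorProduct.tmul_add, mul_add, hy, hy']
        | tmul b' c' =>
          rw [preBaseMulL_tmul, preBaseMulR_tmul, LinearMap.rTensor_tmul, LinearMap.lTensor_tmul,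
            LinearMap.mul'_apply, LinearMap.mul'_apply]
          have h1 : ∀ t : A ⊗[k] A, ((a * b) ⊗ₜ[k] c) *
              LinearMap.rTensor A (actOn a' ∘ₗ B.piBarR) (TensorProduct.comm k A A t) =
              LinearMap.lTensor A (LinearMap.mulLeft k c) (LinearMap.rTensor A
                (LinearMap.mulRight k a' ∘ₗ LinearMap.mulLeft k a ∘ₗ onAct b ∘ₗ B.piBarR)
                (TensorProduct.comm k A A t)) := by
            intro t
            induction t with
            | zero => simp
            | add x y hx hy => simp only [map_add, mul_add, hx, hy]
            | tmul p q =>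
              simp only [TensorProduct.comm_tmul, LinearMap.rTensor_tmul, LinearMap.lTensor_tmul,
                LinearMap.comp_apply, LinearMap.mulLeft_apply, LinearMap.mulRight_apply,
                Algebra.TensorProduct.tmul_mul_tmul]
              rw [B.piBarR_mem q (a * b) a', B.onAct_mul_left (B.piBarR_mem q)]
          have h2 : ∀ t : A ⊗[k] A, LinearMap.lTensor A (onAct c ∘ₗ B.piR) t *
              (a' ⊗ₜ[k] (b' * c')) = LinearMap.rTensor A (LinearMap.mulRight k a')
                (LinearMap.lTensor A (LinearMap.mulLeft k c ∘ₗ LinearMap.mulRight k c' ∘ₗ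
                  actOn b' ∘ₗ B.piR) t) := by
            intro t
            induction t with
            | zero => simp
            | add x y hx hy => simp only [map_add, add_mul, hx, hy]
            | tmul p q =>
              simp only [LinearMap.rTensor_tmul, LinearMap.lTensor_tmul,
                LinearMap.comp_apply, LinearMap.mulLeft_apply, LinearMap.mulRight_apply,
                Algebra.TensorProduct.tmul_mul_tmul]
              rw [← mul_assoc, ← mul_assoc, B.piR_mem q c b']
          have h3 : ∀ q, (LinearMap.mulRight k a' ∘ₗ LinearMap.mulLeft k a ∘ₗ onAct b ∘ₗ
              B.piBarR) q = sliceR B.counit (mulR2 q (B.T₂ (a ⊗ₜ[k] b))) * a' := fun q =>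
            congrArg (· * a') (B.mul_onAct_piBarR q b a)
          have h4 : ∀ q, (LinearMap.mulLeft k c ∘ₗ LinearMap.mulRight k c' ∘ₗ actOn b' ∘ₗ
              B.piR) q = c * sliceR B.counit (mulL2 q (B.T₄ (c' ⊗ₜ[k] b'))) := fun q =>
            congrArg (c * ·) (B.actOn_piR_mul q b' c')
          rw [h1, h2]
          obtain ⟨S, hS⟩ := TensorProduct.exists_finset (B.T₂ (a ⊗ₜ[k] b))
          obtain ⟨S', hS'⟩ := TensorProduct.exists_finset (B.T₄ (c' ⊗ₜ[k] b'))
          generalize LinearMap.mulRight k a' ∘ₗ LinearMap.mulLeft k a ∘ₗ onAct b ∘ₗ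
            B.piBarR = f at h3
          generalize LinearMap.mulLeft k c ∘ₗ LinearMap.mulRight k c' ∘ₗ actOn b' ∘ₗ
            B.piR = g at h4
          rw [hS] at h3 ⊢
          rw [hS'] at h4 ⊢
          simp only [map_sum, TensorProduct.comm_tmul, LinearMap.lTensor_tmul,
            LinearMap.rTensor_tmul, h3, h4, mulR2_tmul, mulL2_tmul, sliceR_tmul,
            TensorProduct.tmul_sum, TensorProduct.sum_tmul, Finset.sum_mul, Finset.mul_sum,
            LinearMap.mulLeft_apply, LinearMap.mulRight_apply, smul_mul_assoc, mul_smul_comm,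
            TensorProduct.smul_tmul]
          exact Finset.sum_comm

theorem exists_isBaseMultiplier : ∃ F, B.IsBaseMultiplier F := by
  have hl : Function.Surjective (LinearMap.lTensor A (LinearMap.mul' k A)) :=
    LinearMap.lTensor_surjective A B.idempotent
  have hr : Function.Surjective (LinearMap.rTensor A (LinearMap.mul' k A)) :=
    LinearMap.rTensor_surjective A B.idempotent
  -- The two actions are defined through linear sections of multiplication. Compatibility and
  -- non-degeneracy make them independent of the sections, which yields the two required formulas.
  obtain ⟨s, hs⟩ := LinearMap.exists_rightInverse_of_surjective _ (LinearMap.range_eq_top.2 hl)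
  obtain ⟨t, ht⟩ := LinearMap.exists_rightInverse_of_surjective _ (LinearMap.range_eq_top.2 hr)
  replace hs := fun y => LinearMap.congr_fun hs y
  replace ht := fun y => LinearMap.congr_fun ht y
  simp only [LinearMap.comp_apply, LinearMap.id_apply] at hs ht
  refine ⟨(B.preBaseMulL ∘ₗ s, MulOpposite.op (B.preBaseMulR ∘ₗ t)), ?_, ?_, ?_⟩
  · intro x y
    change x * B.preBaseMulL (s y) = B.preBaseMulR (t x) * y
    have h := B.preBaseMul_compat (t x) (s y)
    rwa [hs, ht] at h
  · intro a b c
    rw [← preBaseMulL_tmul]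
    change B.preBaseMulL (s (a ⊗ₜ[k] (b * c))) = _
    refine B.tensor_mulLeft_cancel fun z => ?_
    have h1 := B.preBaseMul_compat (t z) (s (a ⊗ₜ[k] (b * c)))
    have h2 := B.preBaseMul_compat (t z) (a ⊗ₜ[k] (b ⊗ₜ[k] c))
    rw [ht] at h1 h2
    rw [h1, h2, hs, LinearMap.lTensor_tmul, LinearMap.mul'_apply]
  · intro a b c
    rw [← preBaseMulR_tmul]
    change B.preBaseMulR (t ((a * b) ⊗ₜ[k] c)) = _
    refine B.tensor_mulRight_cancel fun z => ?_
    have h1 := B.preBaseMul_compat (t ((a * b) ⊗ₜ[k] c)) (s z)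
    have h2 := B.preBaseMul_compat ((a ⊗ₜ[k] b) ⊗ₜ[k] c) (s z)
    rw [hs] at h1 h2
    rw [← h1, ← h2, ht, LinearMap.rTensor_tmul, LinearMap.mul'_apply]

/-! ### Multipliers on `A ⊗ A` -/

theorem actOn_pairTensor (p q : MulPair k A) (x : A ⊗[k] A) :
    actOn x (pairTensor (p ⊗ₜ[k] q)) = TensorProduct.map p.1 q.1 x := rfl

theorem onAct_pairTensor (p q : MulPair k A) (x : A ⊗[k] A) :
    onAct x (pairTensor (p ⊗ₜ[k] q)) = TensorProduct.map p.2.unop q.2.unop x := rfl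

theorem pairTensor_mul (p q p' q' : MulPair k A) :
    pairTensor ((p * p') ⊗ₜ[k] (q * q')) =
      pairTensor (p ⊗ₜ[k] q) * pairTensor (p' ⊗ₜ[k] q') :=
  Prod.ext (TensorProduct.map_comp _ _ _ _)
    (MulOpposite.unop_injective (TensorProduct.map_comp _ _ _ _))

theorem pairTensor_mem {p q : MulPair k A} (hp : p ∈ multiplierAlgebra k A)
    (hq : q ∈ multiplierAlgebra k A) :
    pairTensor (p ⊗ₜ[k] q) ∈ multiplierAlgebra k (A ⊗[k] A) := by
  intro x y
  rw [actOn_pairTensor, onAct_pairTensor]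
  induction x with
  | zero => simp
  | add x x' hx hx' => simp only [map_add, add_mul, hx, hx']
  | tmul a b =>
    induction y with
    | zero => simp
    | add y y' hy hy' => simp only [map_add, mul_add, hy, hy']
    | tmul c d =>
      simp only [TensorProduct.map_tmul, Algebra.TensorProduct.tmul_mul_tmul]
      exact congrArg₂ _ (hp a c) (hq b d)

theorem multiplier_tensor_ext_left (B : RegularWMB k A) {P Q : MulPair k (A ⊗[k] A)}
    (hP : P ∈ multiplierAlgebra k (A ⊗[k] A)) (hQ : Q ∈ multiplierAlgebra k (A ⊗[k] A))
    (h : ∀ a b c : A, actOn (a ⊗ₜ[k] (b * c)) P = actOn (a ⊗ₜ[k] (b * c)) Q) : P = Q := by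
  have h1 : P.1 = Q.1 := TensorProduct.ext' fun a d => by
    refine B.induction_on_mul (p := fun d => P.1 (a ⊗ₜ[k] d) = Q.1 (a ⊗ₜ[k] d)) d ?_ ?_ (h a)
    · simp
    · intro x y hx hy
      rw [TensorProduct.tmul_add, map_add, map_add, hx, hy]
  have h2 : ∀ x, onAct x P = onAct x Q := fun x =>
    B.tensor_mulRight_cancel fun y => (hP x y).symm.trans
      ((congrArg (x * ·) (LinearMap.congr_fun h1 y)).trans (hQ x y))
  exact Prod.ext h1 (MulOpposite.unop_injective (LinearMap.ext h2))

theorem multiplier_tensor_ext_right (B : RegularWMB k A) {P Q : MulPair k (A ⊗[k] A)}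
    (hP : P ∈ multiplierAlgebra k (A ⊗[k] A)) (hQ : Q ∈ multiplierAlgebra k (A ⊗[k] A))
    (h : ∀ a b c : A, onAct ((a * b) ⊗ₜ[k] c) P = onAct ((a * b) ⊗ₜ[k] c) Q) : P = Q := by
  have h1 : P.2.unop = Q.2.unop := TensorProduct.ext' fun d c => by
    refine B.induction_on_mul (p := fun d => P.2.unop (d ⊗ₜ[k] c) = Q.2.unop (d ⊗ₜ[k] c)) d ?_ ?_
      fun a b => h a b c
    · simp
    · intro x y hx hy
      rw [TensorProduct.add_tmul, map_add, map_add, hx, hy]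
  have h2 : ∀ x, actOn x P = actOn x Q := fun x =>
    B.tensor_mulLeft_cancel fun y => (hP y x).trans
      ((congrArg (· * x) (LinearMap.congr_fun h1 y)).trans (hQ y x).symm)
  exact Prod.ext (LinearMap.ext h2) (MulOpposite.unop_injective h1)

theorem tensorIncl_tmul (R : NonUnitalSubalgebra k (MulPair k A)) (r s : R) :
    tensorIncl R (r ⊗ₜ[k] s) = pairTensor ((r : MulPair k A) ⊗ₜ[k] (s : MulPair k A)) := rfl

theorem tensorIncl_mem (x : B.baseAlgebra ⊗[k] B.baseAlgebra) :
    tensorIncl B.baseAlgebra x ∈ multiplierAlgebra k (A ⊗[k] A) := by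
  induction x with
  | zero => rw [map_zero]; exact zero_mem _
  | add x y hx hy => rw [map_add]; exact add_mem hx hy
  | tmul r s => exact pairTensor_mem (B.baseAlgebra_le r.2) (B.baseAlgebra_le s.2)

/-- The evaluations r ↦ r a are jointly injective on R, so they may be cancelled one leg at a time.
Identities in R ⊗ R can thus be checked on multipliers. -/
theorem tensorIncl_injective : Function.Injective (tensorIncl B.baseAlgebra) := by
  intro x y hxy
  have hinj : ∀ r : B.baseAlgebra, (∀ a, (actOn a ∘ₗ B.baseAlgebra.toSubmodule.subtype) r = 0) →
      r = 0 := fun r hr => Subtype.ext (B.multiplier_ext (B.baseAlgebra_le r.2) (zero_mem _)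
        fun a => (hr a).trans (map_zero _).symm)
  refine rTensor_jointly_injective (V := B.baseAlgebra)
    (fun a : A => actOn a ∘ₗ B.baseAlgebra.toSubmodule.subtype) hinj fun a => ?_
  refine lTensor_jointly_injective (V := B.baseAlgebra)
    (fun a : A => actOn a ∘ₗ B.baseAlgebra.toSubmodule.subtype) hinj fun b => ?_
  have h1 : ∀ z, LinearMap.lTensor A (actOn b ∘ₗ B.baseAlgebra.toSubmodule.subtype)
      (LinearMap.rTensor B.baseAlgebra (actOn a ∘ₗ B.baseAlgebra.toSubmodule.subtype) z) =
      actOn (a ⊗ₜ[k] b) (tensorIncl B.baseAlgebra z) := by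
    intro z
    induction z with
    | zero => simp
    | add x y hx hy => simp only [map_add, hx, hy]
    | tmul r s => rfl
  rw [h1, h1, hxy]

theorem tensorIncl_rTensor_mulLeft (r : B.baseAlgebra)
    (x : B.baseAlgebra ⊗[k] B.baseAlgebra) :
    tensorIncl B.baseAlgebra (LinearMap.rTensor B.baseAlgebra (LinearMap.mulLeft k r) x) =
      pairTensor ((r : MulPair k A) ⊗ₜ[k] 1) * tensorIncl B.baseAlgebra x := by
  induction x with
  | zero => simp
  | add x y hx hy => simp only [map_add, mul_add, hx, hy]
  | tmul s t =>
    rw [LinearMap.rTensor_tmul, tensorIncl_tmul, tensorIncl_tmul, ← pairTensor_mul, one_mul]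
    rfl

theorem tensorIncl_lTensor_mulRight (r : B.baseAlgebra)
    (x : B.baseAlgebra ⊗[k] B.baseAlgebra) :
    tensorIncl B.baseAlgebra (LinearMap.lTensor B.baseAlgebra (LinearMap.mulRight k r) x) =
      tensorIncl B.baseAlgebra x * pairTensor (1 ⊗ₜ[k] (r : MulPair k A)) := by
  induction x with
  | zero => simp
  | add x y hx hy => simp only [map_add, add_mul, hx, hy]
  | tmul s t =>
    rw [LinearMap.lTensor_tmul, tensorIncl_tmul, tensorIncl_tmul, ← pairTensor_mul, mul_one]
    rfl

/-! ### The comultiplication and the counit of the base algebra -/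

variable {B} {F : MulPair k (A ⊗[k] A)}

/-- `F (1 ⊗ r) = (r ⊗ 1) F` for `r` in the base algebra. -/
theorem IsBaseMultiplier.mul_comm (hF : B.IsBaseMultiplier F) (hB : B.IsRightFull)
    {r : MulPair k A} (hr : r ∈ B.baseAlgebra) :
    pairTensor (r ⊗ₜ[k] 1) * F = F * pairTensor (1 ⊗ₜ[k] r) := by
  have hrM := B.baseAlgebra_le hr
  refine B.multiplier_tensor_ext_right
    (mul_mem (pairTensor_mem hrM (one_mem _)) hF.1)
    (mul_mem hF.1 (pairTensor_mem (one_mem _) hrM)) fun x y c => ?_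
  rw [onAct_mul, onAct_mul, hF.2.2, onAct_pairTensor, onAct_pairTensor]
  change onAct (onAct (x * y) r ⊗ₜ[k] c) F = LinearMap.lTensor A r.2.unop _
  rw [B.onAct_mul_left hrM, hF.2.2]
  -- Both descriptions of R are needed: Δ(d r) = Δ(d)(1 ⊗ r) uses r = ⊓̄ᴿ(b), while ⊓ᴿ(q)r = ⊓ᴿ(q r)
  -- uses that r lies in the range of ⊓ᴿ.
  obtain ⟨b, rfl⟩ := hB.mem_baseAlgebra.1 hr
  rw [T₂_onAct_piBarR]
  induction B.T₂ (x ⊗ₜ[k] y) with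
  | zero => simp
  | add x y hx hy => simp only [map_add, hx, hy]
  | tmul p q =>
    simp only [LinearMap.lTensor_tmul, LinearMap.comp_apply]
    change p ⊗ₜ[k] onAct c (B.piR (onAct q (B.piBarR b))) = _
    rw [← B.piR_mul hr]
    rfl

/-- `⊓ᴿ(u v₁) ⊗ ⊓ᴿ(v₂) = (⊓ᴿ(u v) ⊗ 1) F`. -/
theorem IsBaseMultiplier.tensorIncl_T₂ (hF : B.IsBaseMultiplier F) (hB : B.IsRightFull)
    (X : A ⊗[k] A) :
    tensorIncl B.baseAlgebra (TensorProduct.map B.piRBase B.piRBase (B.T₂ X)) =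
      pairTensor (B.piR (LinearMap.mul' k A X) ⊗ₜ[k] 1) * F := by
  refine B.multiplier_tensor_ext_left (B.tensorIncl_mem _)
    (mul_mem (pairTensor_mem (B.piR_mem _) (one_mem _)) hF.1) fun a b c => ?_
  rw [actOn_mul, hF.2.1, actOn_pairTensor]
  change _ = LinearMap.rTensor A (B.piR (LinearMap.mul' k A X)).1 _
  have h1 : ∀ t : A ⊗[k] A, actOn (a ⊗ₜ[k] (b * c)) (tensorIncl B.baseAlgebra
      (TensorProduct.map B.piRBase B.piRBase t)) = LinearMap.rTensor A (actOn a ∘ₗ B.piR)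
        (LinearMap.lTensor A (actOn (b * c) ∘ₗ B.piR) t) := by
    intro t
    induction t with
    | zero => simp
    | add x y hx hy => simp only [map_add, hx, hy]
    | tmul p q => rfl
  have h2 : ∀ t : A ⊗[k] A, LinearMap.rTensor A (B.piR (LinearMap.mul' k A X)).1
      (LinearMap.rTensor A (actOn a ∘ₗ B.piBarR) (TensorProduct.comm k A A t)) =
      LinearMap.rTensor A (actOn a ∘ₗ B.piR ∘ₗ onAct (LinearMap.mul' k A X) ∘ₗ B.piBarR)
        (TensorProduct.comm k A A t) := by
    intro t
    induction t with
    | zero => simp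
    | add x y hx hy => simp only [map_add, hx, hy]
    | tmul p q =>
      simp only [TensorProduct.comm_tmul, LinearMap.rTensor_tmul, LinearMap.comp_apply]
      rw [← B.piR_mul (hB.mem_baseAlgebra.2 ⟨q, rfl⟩)]
      rfl
  have h3 : ∀ q, (onAct (LinearMap.mul' k A X) ∘ₗ B.piBarR) q =
      sliceR B.counit (mulR2 q (B.T₂ X)) := fun q => (B.sliceR_mulR2_T₂ X q).symm
  have h4 : ∀ q, (actOn (b * c) ∘ₗ B.piR) q =
      sliceR B.counit (mulL2 q (B.T₄ (c ⊗ₜ[k] b))) := fun q => by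
    rw [← actOn_piR_mul, LinearMap.comp_apply, B.actOn_mul_right (B.piR_mem q)]
  -- On X = u ⊗ v both sides are now ⊓ᴿ(u v₁)a ⊗ b₁ c scaled by ε(v₂ b₂), up to the order of
  -- summation.
  rw [h1, h2]
  obtain ⟨S, hS⟩ := TensorProduct.exists_finset (B.T₂ X)
  obtain ⟨S', hS'⟩ := TensorProduct.exists_finset (B.T₄ (c ⊗ₜ[k] b))
  generalize onAct (LinearMap.mul' k A X) ∘ₗ B.piBarR = f at h3
  generalize actOn (b * c) ∘ₗ B.piR = g at h4
  rw [hS] at h3 ⊢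
  rw [hS'] at h4 ⊢
  simp only [map_sum, TensorProduct.comm_tmul, LinearMap.lTensor_tmul,
    LinearMap.rTensor_tmul, LinearMap.comp_apply, h3, h4, mulR2_tmul, mulL2_tmul, sliceR_tmul,
    TensorProduct.tmul_sum, TensorProduct.sum_tmul, map_smul, TensorProduct.smul_tmul]
  exact Finset.sum_comm

variable (B) in
theorem exists_piRBase_mul'_rightInverse : ∃ s : B.baseAlgebra →ₗ[k] A ⊗[k] A,
    ∀ r, B.piRBase (LinearMap.mul' k A (s r)) = r := by
  obtain ⟨s, hs⟩ := LinearMap.exists_rightInverse_of_surjective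
    (B.piRBase ∘ₗ LinearMap.mul' k A)
    (LinearMap.range_eq_top.2 (B.piRBase_surjective.comp B.idempotent))
  exact ⟨s, fun r => LinearMap.congr_fun hs r⟩

theorem IsBaseMultiplier.exists_comul (hF : B.IsBaseMultiplier F) (hB : B.IsRightFull) :
    ∃ δ : B.baseAlgebra →ₗ[k] B.baseAlgebra ⊗[k] B.baseAlgebra,
      B.IsBaseComul B.baseAlgebra F δ ∧
      (∀ X, δ (B.piRBase (LinearMap.mul' k A X)) =
        TensorProduct.map B.piRBase B.piRBase (B.T₂ X)) ∧
      (∀ r s, δ (r * s) = LinearMap.rTensor B.baseAlgebra (LinearMap.mulLeft k r) (δ s)) ∧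
      (∀ r s, δ (r * s) = LinearMap.lTensor B.baseAlgebra (LinearMap.mulRight k s) (δ r)) := by
  obtain ⟨σ, hσ⟩ := B.exists_piRBase_mul'_rightInverse
  -- The choice of the section σ is harmless: as a multiplier δ(r) is (r ⊗ 1)F, from which both
  -- module laws are read off.
  let δ := TensorProduct.map B.piRBase B.piRBase ∘ₗ B.T₂ ∘ₗ σ
  have h1 : ∀ r : B.baseAlgebra, tensorIncl B.baseAlgebra (δ r) =
      pairTensor ((r : MulPair k A) ⊗ₜ[k] 1) * F := fun r => by
    refine (hF.tensorIncl_T₂ hB (σ r)).trans ?_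
    rw [← coe_piRBase, hσ]
  have h2 : ∀ r : B.baseAlgebra, tensorIncl B.baseAlgebra (δ r) =
      F * pairTensor (1 ⊗ₜ[k] (r : MulPair k A)) := fun r => by
    rw [h1, hF.mul_comm hB r.2]
  refine ⟨δ, fun a r hr => ⟨hr ▸ h1 r, hr ▸ h2 r⟩, fun X => B.tensorIncl_injective ?_,
    fun r s => B.tensorIncl_injective ?_, fun r s => B.tensorIncl_injective ?_⟩
  · rw [h1, hF.tensorIncl_T₂ hB, coe_piRBase]
  · rw [tensorIncl_rTensor_mulLeft, h1, h1, ← mul_assoc, ← pairTensor_mul, one_mul]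
    rfl
  · rw [tensorIncl_lTensor_mulRight, h2, h2, mul_assoc, ← pairTensor_mul, one_mul]
    rfl

theorem IsRightFull.exists_baseCounit (hB : B.IsRightFull) :
    ∃ ε : B.baseAlgebra →ₗ[k] k, B.IsBaseCounit B.baseAlgebra ε ∧
      ∀ a, ε (B.piRBase a) = B.counit a := by
  obtain ⟨σ, hσ⟩ := LinearMap.exists_rightInverse_of_surjective B.piRBase
    (LinearMap.range_eq_top.2 B.piRBase_surjective)
  have h1 : ∀ a, (B.counit ∘ₗ σ) (B.piRBase a) = B.counit a := fun a => by
    rw [← sub_eq_zero, LinearMap.comp_apply, ← map_sub]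
    apply hB.counit_eq_zero
    have h2 : B.piRBase (σ (B.piRBase a)) = B.piRBase a := LinearMap.congr_fun hσ _
    rw [← coe_piRBase, map_sub, h2, sub_self]
    rfl
  refine ⟨B.counit ∘ₗ σ, fun a r hr => ?_, h1⟩
  rw [show r = B.piRBase a from Subtype.ext hr, h1]

variable (B) in
-- Since ⊓ᴿ(x) depends only on ε(x -), it suffices that ε(a b₁) ε(b₂ d) = ε(ab ⊓̄ᴿ(d)) = ε(abd).
-- This becomes the left counit law of δ.
theorem piR_sliceL_T₂ (a b : A) :
    B.piR (sliceL B.counit (B.T₂ (a ⊗ₜ[k] b))) = B.piR (a * b) :=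
  B.piR_congr fun d => by
    rw [← sliceL_mulR2, apply_sliceL, ← mul_onAct_piBarR, ← B.onAct_mul_left (B.piBarR_mem d),
      counit_onAct_piBarR]

end RegularWMB
end WMB

namespace WMB

/-! ### Firm modules over an algebra with a counital bimodule comultiplication. -/

namespace RightModule

variable {k : Type u} [Field k] {S : Type v} [NonUnitalRing S] [Module k S]
  {M : Type w} [AddCommGroup M] [Module k M] (ρ : RightModule k S M)

/-- The map `m ⊗ r ↦ m r₁ ⊗ r₂` for a map `δ : S → S ⊗ S`, `r ↦ r₁ ⊗ r₂`. -/
def comulAct (δ : S →ₗ[k] S ⊗[k] S) : M ⊗[k] S →ₗ[k] M ⊗[k] S :=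
  LinearMap.rTensor S (TensorProduct.lift ρ.act) ∘ₗ
    (TensorProduct.assoc k M S S).symm.toLinearMap ∘ₗ LinearMap.lTensor M δ

theorem comulAct_tmul (δ : S →ₗ[k] S ⊗[k] S) (m : M) (r : S) :
    ρ.comulAct δ (m ⊗ₜ[k] r) = LinearMap.rTensor S (ρ.act m) (δ r) := by
  simp only [comulAct, LinearMap.comp_apply, LinearMap.lTensor_tmul, LinearEquiv.coe_coe]
  induction δ r with
  | zero => simp
  | add x y hx hy => simp only [TensorProduct.tmul_add, map_add, hx, hy]
  | tmul => simp

theorem rTensor_act_act (m : M) (r : S) [IsScalarTower k S S] [SMulCommClass k S S]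
    (x : S ⊗[k] S) : LinearMap.rTensor S (ρ.act (ρ.act m r)) x =
      LinearMap.rTensor S (ρ.act m) (LinearMap.rTensor S (LinearMap.mulLeft k r) x) := by
  induction x with
  | zero => simp
  | add x y hx hy => simp only [map_add, hx, hy]
  | tmul => simp [ρ.act_mul]

theorem slice_eq (ψ : M →ₗ[k] k) (m : M) (x : S ⊗[k] S) : ρ.slice ψ m x =
    TensorProduct.lid k S (LinearMap.rTensor S ψ (LinearMap.rTensor S (ρ.act m) x)) := by
  rw [slice, LinearMap.rTensor_comp]
  rfl

variable [IsScalarTower k S S] [SMulCommClass k S S]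

/-- For a firm module `M` over an algebra `S` with a counital bimodule map `δ : S → S ⊗ S`,
composition with the counit identifies the module maps `M → S` with the functionals on `M`. -/
theorem IsFirm.exists_homToBase_equiv {ρ : RightModule k S M} (hρ : ρ.IsFirm)
    (δ : S →ₗ[k] S ⊗[k] S) (ε : S →ₗ[k] k)
    (hδl : ∀ r s, δ (r * s) = LinearMap.rTensor S (LinearMap.mulLeft k r) (δ s))
    (hδr : ∀ r s, δ (r * s) = LinearMap.lTensor S (LinearMap.mulRight k s) (δ r))
    (hεl : ∀ r, TensorProduct.lid k S (LinearMap.rTensor S ε (δ r)) = r)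
    (hεr : ∀ r, TensorProduct.rid k S (LinearMap.lTensor S ε (δ r)) = r) :
    ∃ e : ρ.homToBase ≃ₗ[k] (M →ₗ[k] k),
      (∀ Ψ : ρ.homToBase, e Ψ = ε ∘ₗ (Ψ : M →ₗ[k] S)) ∧
      (∀ (ψ : M →ₗ[k] k) (m : M) (r : S),
        (e.symm ψ : M →ₗ[k] S) (ρ.act m r) = ρ.slice ψ m (δ r)) := by
  have hker : ρ.balanced ≤ LinearMap.ker (ρ.comulAct δ) := by
    rw [balanced, Submodule.span_le]
    rintro _ ⟨m, r, s, rfl⟩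
    rw [SetLike.mem_coe, LinearMap.mem_ker, map_sub, comulAct_tmul, comulAct_tmul, hδl,
      rTensor_act_act, sub_self]
  let E := LinearEquiv.ofBijective ρ.tensorAct hρ
  -- Left linearity of δ lets m ⊗ r ↦ m r₁ ⊗ r₂ descend to M ⊗_S S, and firmness transports it to
  -- `M`.
  let c : M →ₗ[k] M ⊗[k] S := ρ.balanced.liftQ (ρ.comulAct δ) hker ∘ₗ E.symm.toLinearMap
  have hc : ∀ m r, c (ρ.act m r) = LinearMap.rTensor S (ρ.act m) (δ r) := by
    intro m r
    have h1 : E.symm (ρ.act m r) = Submodule.Quotient.mk (m ⊗ₜ[k] r) := by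
      rw [LinearEquiv.symm_apply_eq]
      simp [E, tensorAct]
    change ρ.balanced.liftQ (ρ.comulAct δ) hker (E.symm (ρ.act m r)) = _
    rw [h1, Submodule.liftQ_apply, comulAct_tmul]
  have hind : ∀ {p : M → Prop} (m : M), p 0 → (∀ x y, p x → p y → p (x + y)) →
      (∀ x r, p (ρ.act x r)) → p m := by
    intro p m h0 hadd hact
    obtain ⟨q, rfl⟩ := hρ.2 m
    obtain ⟨t, rfl⟩ := Submodule.Quotient.mk_surjective _ q
    change p (TensorProduct.lift ρ.act t)
    induction t with
    | zero => simpa using h0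
    | add x y hx hy => rw [map_add]; exact hadd _ _ hx hy
    | tmul m r => exact hact m r
  have hcr : ∀ m s, c (ρ.act m s) = LinearMap.lTensor M (LinearMap.mulRight k s) (c m) := by
    intro m s
    refine hind (p := fun m => c (ρ.act m s) =
      LinearMap.lTensor M (LinearMap.mulRight k s) (c m)) m (by simp) ?_ ?_
    · intro x y hx hy
      simp only [map_add, LinearMap.add_apply, hx, hy]
    · intro x r
      rw [← ρ.act_mul, hc, hc, hδr]
      induction δ r with
      | zero => simp
      | add x y hx hy => simp only [map_add, hx, hy]
      | tmul => simp
  let inv : (M →ₗ[k] k) → (M →ₗ[k] S) := fun ψ =>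
    (TensorProduct.lid k S).toLinearMap ∘ₗ LinearMap.rTensor S ψ ∘ₗ c
  have hinv : ∀ ψ m r, inv ψ (ρ.act m r) = ρ.slice ψ m (δ r) := by
    intro ψ m r
    rw [slice_eq, ← hc]
    rfl
  have hmem : ∀ ψ, inv ψ ∈ ρ.homToBase := by
    intro ψ m s
    change TensorProduct.lid k S (LinearMap.rTensor S ψ (c (ρ.act m s))) =
      TensorProduct.lid k S (LinearMap.rTensor S ψ (c m)) * s
    rw [hcr]
    induction c m with
    | zero => simp
    | add x y hx hy => simp only [map_add, add_mul, hx, hy]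
    | tmul => simp [smul_mul_assoc]
  let e : ρ.homToBase ≃ₗ[k] (M →ₗ[k] k) :=
    { toFun := fun Ψ => ε ∘ₗ (Ψ : M →ₗ[k] S)
      map_add' := fun Ψ Φ => by simp [LinearMap.comp_add]
      map_smul' := fun a Ψ => by simp [LinearMap.comp_smul]
      invFun := fun ψ => ⟨inv ψ, hmem ψ⟩
      left_inv := fun Ψ => by
        obtain ⟨Ψ, hΨ⟩ := Ψ
        refine Subtype.ext (LinearMap.ext fun m => ?_)
        refine hind (p := fun m => inv (ε ∘ₗ Ψ) m = Ψ m) m (by simp) ?_ ?_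
        · intro x y hx hy
          rw [map_add, map_add, hx, hy]
        · intro x r
          rw [hinv, slice_eq, hΨ x r]
          -- Left linearity of δ gives Ψ(x) r = ε(Ψ(x) r₁) r₂, which is where Ψ being a module map
          -- meets the left counit law.
          conv_rhs => rw [← hεl (Ψ x * r), hδl]
          induction δ r with
          | zero => simp
          | add x y hx hy => simp only [map_add, hx, hy]
          | tmul p q => simp [hΨ x p]
      right_inv := fun ψ => by
        refine LinearMap.ext fun m => ?_
        refine hind (p := fun m => ε (inv ψ m) = ψ m) m (by simp) ?_ ?_
        · intro x y hx hy
          rw [map_add, map_add, map_add, hx, hy]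
        · intro x r
          rw [hinv, slice_eq]
          -- The right counit law: ψ(x r₁) ε(r₂) = ψ(x r).
          conv_rhs => rw [← hεr r]
          induction δ r with
          | zero => simp
          | add x y hx hy => simp only [map_add, hx, hy]
          | tmul p q => simp [mul_comm] }
  exact ⟨e, fun _ => rfl, hinv⟩

end RightModule

end WMB

end

/-! ### Counit laws of the base algebra and conclusion. -/

theorem mainTheorem9 {k : Type u} [Field k] {A : Type v} [NonUnitalRing A] [Module k A]
    [IsScalarTower k A A] [SMulCommClass k A A]
    (B : WMB.RegularWMB k A) (hB : B.IsRightFull) :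
    ∃ (R : NonUnitalSubalgebra k (WMB.MulPair k A)) (F : WMB.MulPair k (A ⊗[k] A))
      (δ : R →ₗ[k] R ⊗[k] R) (ε : R →ₗ[k] k),
      B.IsBaseAlgebra R ∧ B.IsBaseMultiplier F ∧ B.IsBaseComul R F δ ∧ B.IsBaseCounit R ε ∧
      ∀ (M : Type w) [AddCommGroup M] [Module k M] (ρ : WMB.RightModule k R M), ρ.IsFirm →
        ∃ e : ρ.homToBase ≃ₗ[k] (M →ₗ[k] k),
          (∀ Ψ : ρ.homToBase, e Ψ = ε ∘ₗ (Ψ : M →ₗ[k] R)) ∧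
          (∀ (ψ : M →ₗ[k] k) (m : M) (r : R),
            (e.symm ψ : M →ₗ[k] R) (ρ.act m r) = ρ.slice ψ m (δ r)) := by
  obtain ⟨F, hF⟩ := B.exists_isBaseMultiplier
  obtain ⟨δ, hδ, hδT, hδl, hδr⟩ := hF.exists_comul hB
  obtain ⟨ε, hε, hεπ⟩ := hB.exists_baseCounit
  obtain ⟨σ, hσ⟩ := B.exists_piRBase_mul'_rightInverse
  have hcl : ∀ X, TensorProduct.lid k B.baseAlgebra (LinearMap.rTensor B.baseAlgebra ε
      (δ (B.piRBase (LinearMap.mul' k A X)))) = B.piRBase (LinearMap.mul' k A X) := by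
    intro X
    have h1 : ∀ t : A ⊗[k] A, TensorProduct.lid k B.baseAlgebra (LinearMap.rTensor B.baseAlgebra ε
        (TensorProduct.map B.piRBase B.piRBase t)) =
        B.piRBase (WMB.sliceL B.counit t) := by
      intro t
      induction t with
      | zero => simp
      | add x y hx hy => simp only [map_add, hx, hy]
      | tmul p q => simp [hεπ]
    rw [hδT, h1]
    induction X with
    | zero => simp
    | add x y hx hy => simp only [map_add, hx, hy]
    | tmul a b => exact Subtype.ext (B.piR_sliceL_T₂ a b)
  have hcr : ∀ X, TensorProduct.rid k B.baseAlgebra (LinearMap.lTensor B.baseAlgebra ε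
      (δ (B.piRBase (LinearMap.mul' k A X)))) = B.piRBase (LinearMap.mul' k A X) := by
    intro X
    have h1 : ∀ t : A ⊗[k] A, TensorProduct.rid k B.baseAlgebra (LinearMap.lTensor B.baseAlgebra ε
        (TensorProduct.map B.piRBase B.piRBase t)) =
        B.piRBase (WMB.sliceR B.counit t) := by
      intro t
      induction t with
      | zero => simp
      | add x y hx hy => simp only [map_add, hx, hy]
      | tmul p q => simp [hεπ]
    rw [hδT, h1]
    -- The right counit law of δ is the counit axiom of T₂ itself; the left one needed ⊓ᴿ to absorb
    -- the discrepancy.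
    exact congrArg B.piRBase (LinearMap.congr_fun B.counit_T₂ X)
  refine ⟨B.baseAlgebra, F, δ, ε, hB.isBaseAlgebra, hF, hδ, hε, fun M _ _ ρ hρ =>
    hρ.exists_homToBase_equiv δ ε hδl hδr (fun r => ?_) (fun r => ?_)⟩
  · rw [← hσ r, hcl]
  · rw [← hσ r, hcr]
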